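/- \textbf{Model.} The horizontal projection of the UAV is the origin of $\mathbb R^2$. Terrestrial base stations (TBSs) form a homogeneous Poisson point process (PPP) of density $\lambda_{tb}>0$ in $\mathbb R^2$. Dedicated base stations (BSs) form a Poisson line Cox process together with a typical line $L_0$: the lines other than $L_0$ are $\{v:\langle v,(\cos\varphi,\sin\varphi)\rangle=\rho\}$ with parameters $(\rho,\varphi)$ forming a PPP of density $\lambda_l>0$ on $[0,\infty)\times[0,2\pi)$; $L_0$ is a given line at distance $y_l\ge 0$ from the origin; each of these lines carries a one-dimensional PPP of BSs of density $\lambda_p>0$, and the line process and the PPPs on the different lines are all independent. Conditionally on the locations, the links of the different BSs to the UAV are independently LoS or NLoS, a BS at horizontal distance $r$ being LoS with probability $$P_l(r)=\frac{1}{1+a\exp\left(-b\left(\frac{180}{\pi}\arctan\left(\frac{\Delta h}{r}\right)-a\right)\right)}$$ and NLoS with probability $P_n(r)=1-P_l(r)$, where $a>0$ and $b$ are environment parameters and $\Delta h$ is the height of the UAV minus the height of the BS, so $\Delta h=h_u-h_{tb}$ for TBSs and $\Delta h=h_u-h_{db}$ for dedicated BSs. For $c\in\{l,n\}$ let $R_{tb,c}$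 and $R_{db,c}$ be the horizontal distances from the UAV to the nearest LoS ($c=l$) or NLoS ($c=n$) TBS and dedicated BS (the latter among the BSs on $L_0$ and on all the other lines), for the given value of $y_l$. \textbf{Lemma.} For $c\in\{l,n\}$, the distances $R_{tb,c}$ and $R_{db,c}$ are almost surely finite and have the following CDFs and PDFs; both PDFs vanish for $r\le0$. For the TBSs and $r>0$, $$F_{R_{tb,c}}(r)=1-\exp\left(-2\pi\lambda_{tb}\int_0^r zP_c(z)\,dz\right),$$ $$f_{R_{tb,c}}(r)=2\pi\lambda_{tb}\,r\,P_c(r)\exp\left(-2\pi\lambda_{tb}\int_0^r zP_c(z)\,dz\right).$$ For the dedicated BSs put $$E_c(r,\rho)=\exp\left(-2\lambda_p\int_0^{\sqrt{r^2-\rho^2}}P_c(\sqrt{\rho^2+z^2})\,dz\right),\qquad G_c(r)=2\pi\lambda_l\int_0^r\left(1-E_c(r,\rho)\right)d\rho,$$ $$T_c(r,\theta)=2\lambda_p\int_0^{r\cos\theta}P_c\left(\sqrt{z^2+r^2\sin^2\theta}\right)dz,\qquad H_c(r)=2\pi\lambda_l\int_0^r 2\lambda_p\frac{r}{\sqrt{r^2-\rho^2}}P_c(r)E_c(r,\rho)\,d\rho.$$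 For $r>0$ with $r\ge y_l$, with $\theta_d=\arcsin(y_l/r)$, the CDF of $R_{db,c}$ is $$F_{R_{db,c}}(r,\theta_d)=1-\exp\left(-T_c(r,\theta_d)-G_c(r)\right),$$ and for $0\le r<y_l$ it is $1-\exp(-G_c(r))$. The PDF of $R_{db,c}$ is, for almost every $r>y_l$, $$f_{R_{db,c}}(r,\theta_d)=\left[\frac{2\lambda_pP_c(r)}{\cos\theta_d}+H_c(r)\right]\exp\left(-T_c(r,\theta_d)-G_c(r)\right),$$ and for almost every $0<r<y_l$ it is $H_c(r)\exp(-G_c(r))$. -/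

import Mathlib

open MeasureTheory ProbabilityTheory
open scoped ENNReal

noncomputable section

namespace UAVNetwork

/-- The horizontal plane; the reference UAV hovers above the origin. -/
abbrev Plane : Type := EuclideanSpace ℝ (Fin 2)

/-- The two kinds of link: line of sight and non line of sight. -/
inductive Link where
  | los
  | nlos

/-! ### Line-of-sight probability -/

/-- `P_l(r) = 1 / (1 + a exp (-b ((180/π) arctan (Δh / r) - a)))`, for a base station at horizontal
distance `r > 0` and height difference `Δh`. -/
def losProb (a b Δh r : ℝ) : ℝ :=
  1 / (1 + a * Real.exp (-b * (180 / Real.pi * Real.arctan (Δh / r) - a)))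

/-- `P_l` and `P_n = 1 - P_l`. -/
def linkProb (a b Δh : ℝ) : Link → ℝ → ℝ
  | Link.los, r => losProb a b Δh r
  | Link.nlos, r => 1 - losProb a b Δh r

/-! ### Point processes, given by a measurable enumeration `X 0, X 1, …` of their points -/

section Processes

variable {Ω : Type*} [MeasurableSpace Ω]

/-- The number of points of the process lying in `B`. -/
def pointCount {E : Type*} (X : ℕ → Ω → E) (B : Set E) (ω : Ω) : ℕ∞ :=
  Set.encard {i | X i ω ∈ B}

/-- `X` enumerates a Poisson point process with intensity measure `Λ`: the number of points in a
measurable set of finite intensity is Poisson distributed, and the numbers of points in disjoint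
such sets are independent. -/
structure IsPPP {E : Type*} [MeasurableSpace E] (X : ℕ → Ω → E) (Λ : Measure E)
    (μ : Measure Ω) : Prop where
  measurable : ∀ i, Measurable (X i)
  poisson : ∀ B : Set E, MeasurableSet B → Λ B ≠ ∞ →
    ∀ n : ℕ, μ {ω | pointCount X B ω = (n : ℕ∞)} = poissonMeasure (Λ B).toNNReal {n}
  indep : ∀ (m : ℕ) (B : Fin m → Set E), (∀ k, MeasurableSet (B k)) → (∀ k, Λ (B k) ≠ ∞) →
    Pairwise (fun k l => Disjoint (B k) (B l)) → iIndepFun (fun k => pointCount X (B k)) μ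

/-- `S i` is the event that the base station at `X i` has a line-of-sight link to the UAV.
Conditionally on all locations, these events are independent, and the one of a base station at
horizontal distance `r` has probability `p r`. -/
structure IsLoSMarking {ι : Type*} (X : ι → Ω → Plane) (S : ι → Set Ω) (p : ℝ → ℝ)
    (μ : Measure Ω) : Prop where
  measurableSet : ∀ i, MeasurableSet (S i)
  cond_indep : ∀ (I : Finset ι) (A : Set (ι → Plane)), MeasurableSet A →
    μ ({ω | (fun i => X i ω) ∈ A} ∩ ⋂ i ∈ I, S i) =
      ∫⁻ ω in {ω | (fun i => X i ω) ∈ A}, ∏ i ∈ I, ENNReal.ofReal (p ‖X i ω‖) ∂μ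

/-- The event that the link to base station `i` is of kind `c`. -/
def linkEvent {ι : Type*} (S : ι → Set Ω) : Link → ι → Set Ω
  | Link.los, i => S i
  | Link.nlos, i => (S i)ᶜ

/-- The distance from the origin to the nearest of the base stations `i` for which the event `S i`
holds (`∞` if there is none). -/
def nearestDist {ι : Type*} (X : ι → Ω → Plane) (S : ι → Set Ω) (ω : Ω) : ℝ≥0∞ :=
  ⨅ (i : ι) (_ : ω ∈ S i), ENNReal.ofReal ‖X i ω‖

/-! ### Poisson line Cox process together with a typical line -/

/-- The point with abscissa `t` on the line `{v | ⟪v, (cos φ, sin φ)⟫ = ρ}`; the abscissa is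
measured from the foot of the perpendicular dropped from the origin. -/
def linePoint (ρ φ t : ℝ) : Plane :=
  !₂[ρ * Real.cos φ - t * Real.sin φ, ρ * Real.sin φ + t * Real.cos φ]

/-- Intensity measure of a Poisson line process of line density `ll`: `ll` times Lebesgue measure
on the line parameters `(ρ, φ) ∈ [0, ∞) × [0, 2π)`. -/
def lineIntensity (ll : ℝ) : Measure (ℝ × ℝ) :=
  ENNReal.ofReal ll •
    (volume : Measure (ℝ × ℝ)).restrict (Set.Ici 0 ×ˢ Set.Ico 0 (2 * Real.pi))

/-- `L` enumerates the parameters of the lines of a Poisson line process; `T (some j)` are the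
abscissas of the points on its `j`-th line, and `T none` those of the points on the typical line.
On every line the points form a one-dimensional Poisson process of density `lp`, and the line
process and the point processes on the different lines are all independent. -/
structure IsPLCP (L : ℕ → Ω → ℝ × ℝ) (T : Option ℕ → ℕ → Ω → ℝ) (ll lp : ℝ)
    (μ : Measure Ω) : Prop where
  lines : IsPPP L (lineIntensity ll) μ
  points : ∀ o, IsPPP (T o) (ENNReal.ofReal lp • (volume : Measure ℝ)) μ
  indep_lines : IndepFun (fun ω j => L j ω) (fun ω o k => T o k ω) μ
  indep_points : iIndepFun (fun (o : Option ℕ) ω k => T o k ω) μ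

/-- Locations of all points of the Cox process and of the typical line, the latter being the line
at distance `y` from the origin with normal direction `φ₀`. -/
def coxPoint (L : ℕ → Ω → ℝ × ℝ) (T : Option ℕ → ℕ → Ω → ℝ) (y φ₀ : ℝ) :
    Option ℕ × ℕ → Ω → Plane
  | (none, k), ω => linePoint y φ₀ (T none k ω)
  | (some j, k), ω => linePoint (L j ω).1 (L j ω).2 (T (some j) k ω)

end Processes

/-! ### The explicit CDFs and PDFs, for a link probability `P` -/

/-- CDF of the distance to the nearest terrestrial base station. -/
def cdfTB (ltb : ℝ) (P : ℝ → ℝ) (r : ℝ) : ℝ :=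
  1 - Real.exp (-(2 * Real.pi * ltb * ∫ z in (0 : ℝ)..r, z * P z))

/-- PDF of the distance to the nearest terrestrial base station. -/
def pdfTB (ltb : ℝ) (P : ℝ → ℝ) (r : ℝ) : ℝ :=
  2 * Real.pi * ltb * r * P r * Real.exp (-(2 * Real.pi * ltb * ∫ z in (0 : ℝ)..r, z * P z))

/-- Exponent contributed by the typical line. -/
def typicalTerm (lp : ℝ) (P : ℝ → ℝ) (r θ : ℝ) : ℝ :=
  2 * lp * ∫ z in (0 : ℝ)..(r * Real.cos θ), P (Real.sqrt (z ^ 2 + r ^ 2 * Real.sin θ ^ 2))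

/-- `exp (-2 λ_p ∫_0^√(r²-ρ²) P(√(ρ²+z²)) dz)`, for a line at distance `ρ` from the origin. -/
def lineVoid (lp : ℝ) (P : ℝ → ℝ) (r ρ : ℝ) : ℝ :=
  Real.exp (-(2 * lp * ∫ z in (0 : ℝ)..Real.sqrt (r ^ 2 - ρ ^ 2), P (Real.sqrt (ρ ^ 2 + z ^ 2))))

/-- Exponent contributed by the other lines. -/
def generalTerm (ll lp : ℝ) (P : ℝ → ℝ) (r : ℝ) : ℝ :=
  2 * Real.pi * ll * ∫ ρ in (0 : ℝ)..r, (1 - lineVoid lp P r ρ)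

/-- Rate contributed to the PDF by the other lines. -/
def generalRate (ll lp : ℝ) (P : ℝ → ℝ) (r : ℝ) : ℝ :=
  2 * Real.pi * ll *
    ∫ ρ in (0 : ℝ)..r, 2 * lp * (r / Real.sqrt (r ^ 2 - ρ ^ 2)) * P r * lineVoid lp P r ρ

/-- CDF of the distance to the nearest dedicated base station, at a distance `r` that reaches the
typical line. -/
def cdfDB (ll lp : ℝ) (P : ℝ → ℝ) (r θ : ℝ) : ℝ :=
  1 - Real.exp (-typicalTerm lp P r θ - generalTerm ll lp P r)

/-- PDF of the distance to the nearest dedicated base station, at a distance `r` that reaches the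
typical line. -/
def pdfDB (ll lp : ℝ) (P : ℝ → ℝ) (r θ : ℝ) : ℝ :=
  (2 * lp * P r / Real.cos θ + generalRate ll lp P r) *
    Real.exp (-typicalTerm lp P r θ - generalTerm ll lp P r)

/-- CDF at a distance `r` that does not reach the typical line. -/
def cdfDBShort (ll lp : ℝ) (P : ℝ → ℝ) (r : ℝ) : ℝ :=
  1 - Real.exp (-generalTerm ll lp P r)

/-- PDF at a distance `r` that does not reach the typical line. -/
def pdfDBShort (ll lp : ℝ) (P : ℝ → ℝ) (r : ℝ) : ℝ :=
  generalRate ll lp P r * Real.exp (-generalTerm ll lp P r)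

end UAVNetwork

end

noncomputable section

namespace UAVNetwork

open Set Filter Topology

/-! ### The exponential of a negated extended nonnegative real -/

/-! Condition on the locations. The nearest marked point lies at distance at least `r` exactly when
every point of the open disc of radius `r` is unmarked, which has conditional probability `∏ (1 - p
‖x‖)` over the points of the disc (`IsLoSMarking.measure_le_nearestDist`). The survival function is
thus the mean of a product of weights over the points, a probability generating functional.

For a Poisson process this mean is `exp (-∫ (1 - g) dΛ)` (`IsPPP.lintegral_infProd`); in the plane,
polar coordinates give the terrestrial exponent. For the Cox process the formula is used twice
(`IsPLCP.lintegral_iInf_prod`). Given the lines, each line contributes the probability that none of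
its points in the disc is marked. Averaging the product of these over the Poisson lines gives the
general exponent, and the typical line gives a separate factor.

The densities come without differentiating. Every exponent is written as `∫_0^r u` for a merely
measurable hazard rate `u`, and a variable with survival function `exp (-∫_0^r u)` has density `u(r)
exp (-∫_0^r u)` (`map_toReal_eq_withDensity`). This rests on `∫_0^r u(s) exp (-∫_0^s u) ds = 1 - exp
(-∫_0^r u)`, proved in `lintegral_hazard_mul_expNeg` by showing that the cumulative hazard is
uniformly distributed under `u ds`. On one line the hazard comes from the substitution `s² = ρ² +
t²`. For the line process the same identity is applied at fixed `ρ`, and Tonelli exchanges `ρ` and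
`s` (`lintegral_one_sub_lineMiss_eq_coxHazard`).

NLoS links are again independent marks, with probability `1 - p` (`IsLoSMarking.compl`), so both
kinds are treated alike. Link probabilities are bounded away from `0` (`exists_pos_le_linkProb`), so
the cumulative hazard is unbounded and the distances are almost surely finite. -/

/-- `exp (-x)`, for a finite `x`. -/
def expNeg (x : ℝ≥0∞) : ℝ≥0∞ := ENNReal.ofReal (Real.exp (-x.toReal))

lemma expNeg_zero : expNeg 0 = 1 := by simp [expNeg]

lemma expNeg_le_one (x : ℝ≥0∞) : expNeg x ≤ 1 := by
  rw [expNeg, ENNReal.ofReal_le_one, Real.exp_le_one_iff]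
  simp

lemma expNeg_ne_top (x : ℝ≥0∞) : expNeg x ≠ ∞ := ENNReal.ofReal_ne_top

lemma measurable_expNeg : Measurable expNeg := by
  unfold expNeg
  fun_prop

/-- Finiteness matters: `toReal` sends `∞` to `0`, so `expNeg ∞ = 1`. -/
lemma expNeg_add {x y : ℝ≥0∞} (hx : x ≠ ∞) (hy : y ≠ ∞) :
    expNeg (x + y) = expNeg x * expNeg y := by
  rw [expNeg, expNeg, expNeg, ENNReal.toReal_add hx hy, neg_add, Real.exp_add,
    ENNReal.ofReal_mul (Real.exp_nonneg _)]

lemma expNeg_sum {ι : Type*} (s : Finset ι) (x : ι → ℝ≥0∞) (hx : ∀ i ∈ s, x i ≠ ∞) :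
    ∏ i ∈ s, expNeg (x i) = expNeg (∑ i ∈ s, x i) := by
  classical
  induction s using Finset.induction_on with
  | empty => simp [expNeg_zero]
  | insert i s hi ih =>
    rw [Finset.prod_insert hi, Finset.sum_insert hi, ih fun j hj => hx j (by simp [hj]),
      expNeg_add (hx i (by simp))]
    exact ENNReal.sum_ne_top.2 fun j hj => hx j (by simp [hj])

lemma one_sub_expNeg (x : ℝ≥0∞) : 1 - expNeg x = ENNReal.ofReal (1 - Real.exp (-x.toReal)) := by
  rw [expNeg, ENNReal.ofReal_sub _ (Real.exp_nonneg _), ENNReal.ofReal_one]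

lemma lintegral_exp_neg_Ioc {M : ℝ} (hM : 0 ≤ M) :
    ∫⁻ x in Ioc 0 M, ENNReal.ofReal (Real.exp (-x)) = ENNReal.ofReal (1 - Real.exp (-M)) := by
  rw [← ofReal_integral_eq_lintegral_ofReal, ← intervalIntegral.integral_of_le hM]
  · congr 1
    have := intervalIntegral.integral_comp_neg (a := 0) (b := M) (fun x => Real.exp x)
    rw [this, integral_exp]
    simp
  · exact (Continuous.integrableOn_Icc (by fun_prop)).mono_set Ioc_subset_Icc_self
  · exact Eventually.of_forall fun x => Real.exp_nonneg _

/-! ### The distribution with a given hazard rate -/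

lemma monotone_cumulative (u : ℝ → ℝ≥0∞) (a : ℝ) : Monotone fun s => ∫⁻ x in Ioo a s, u x :=
  fun _ _ h => lintegral_mono_set (Ioo_subset_Ioo_right h)

/-- The primitive of an integrable function is continuous, so the intermediate value theorem
applies. -/
lemma exists_cumulative_eq {u : ℝ → ℝ≥0∞} (hu : Measurable u) {a r : ℝ} (har : a ≤ r)
    (hfin : ∫⁻ x in Ioo a r, u x ≠ ∞) {t : ℝ} (ht : 0 ≤ t)
    (htr : t ≤ (∫⁻ x in Ioo a r, u x).toReal) :
    ∃ σ ∈ Icc a r, ∫⁻ x in Ioo a σ, u x = ENNReal.ofReal t := by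
  have hint : IntegrableOn (fun x => (u x).toReal) (Ioc a r) := by
    refine integrable_toReal_of_lintegral_ne_top hu.aemeasurable ?_
    rwa [setLIntegral_congr Ioo_ae_eq_Ioc.symm]
  have hcont : ContinuousOn (fun s => ∫ x in a..s, (u x).toReal) (Icc a r) := by
    have := intervalIntegral.continuousOn_primitive_interval (μ := volume) (a := a) (b := r)
      (f := fun x => (u x).toReal)
    rw [uIcc_of_le har] at this
    exact this ((integrableOn_Icc_iff_integrableOn_Ioc).2 hint)
  have hle : ∀ s ∈ Icc a r, ∫⁻ x in Ioo a s, u x ≠ ∞ := fun s hs =>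
    ne_top_of_le_ne_top hfin (monotone_cumulative u a hs.2)
  have heq : ∀ s ∈ Icc a r, ∫ x in a..s, (u x).toReal = (∫⁻ x in Ioo a s, u x).toReal := by
    intro s hs
    rw [intervalIntegral.integral_of_le hs.1, integral_Ioc_eq_integral_Ioo,
      integral_toReal hu.aemeasurable (ae_lt_top hu (hle s hs))]
  have := intermediate_value_Icc har hcont
  have hmem : t ∈ Icc (∫ x in a..a, (u x).toReal) (∫ x in a..r, (u x).toReal) := by
    rw [heq r ⟨har, le_rfl⟩]
    simpa using ⟨ht, htr⟩
  obtain ⟨σ, hσ, h⟩ := this hmem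
  refine ⟨σ, hσ, ?_⟩
  simp only at h
  rw [heq σ hσ] at h
  rw [← h, ENNReal.ofReal_toReal (hle σ hσ)]

/-- The integral transformation: under the measure with density `u`, the cumulative
hazard `∫_a^s u` is uniformly distributed. -/
lemma map_cumulative {u : ℝ → ℝ≥0∞} (hu : Measurable u) {a r : ℝ} (har : a ≤ r)
    (hfin : ∫⁻ x in Ioo a r, u x ≠ ∞) :
    ((volume.restrict (Ioo a r)).withDensity u).map (fun s => (∫⁻ x in Ioo a s, u x).toReal) =
      volume.restrict (Ioc 0 (∫⁻ x in Ioo a r, u x).toReal) := by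
  set M := (∫⁻ x in Ioo a r, u x).toReal with hM
  have hmeas : Measurable fun s => (∫⁻ x in Ioo a s, u x).toReal :=
    (monotone_cumulative u a).measurable.ennreal_toReal
  have hνuniv : (volume.restrict (Ioo a r)).withDensity u univ = ENNReal.ofReal M := by
    rw [withDensity_apply _ MeasurableSet.univ, Measure.restrict_univ, hM,
      ENNReal.ofReal_toReal hfin]
  have hν : ∀ σ ∈ Icc a r, (volume.restrict (Ioo a r)).withDensity u (Ioo a σ) =
      ∫⁻ x in Ioo a σ, u x := by
    intro σ hσ
    rw [withDensity_apply _ measurableSet_Ioo, Measure.restrict_restrict measurableSet_Ioo,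
      inter_eq_self_of_subset_left (Ioo_subset_Ioo_right hσ.2)]
  have : IsFiniteMeasure ((volume.restrict (Ioo a r)).withDensity u) :=
    ⟨by rw [hνuniv]; exact ENNReal.ofReal_lt_top⟩
  have hae : ∀ᵐ s ∂(volume.restrict (Ioo a r)).withDensity u, s ∈ Ioo a r :=
    (withDensity_absolutelyContinuous _ _).ae_le (ae_restrict_mem measurableSet_Ioo)
  have hfin' : ∀ s ∈ Icc a r, ∫⁻ x in Ioo a s, u x ≠ ∞ := fun s hs =>
    ne_top_of_le_ne_top hfin (monotone_cumulative u a hs.2)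
  refine Measure.ext_of_Iic _ _ fun t => ?_
  rw [Measure.map_apply hmeas measurableSet_Iic, Measure.restrict_apply measurableSet_Iic]
  rcases lt_or_ge t 0 with ht | ht
  · have h1 : (fun s => (∫⁻ x in Ioo a s, u x).toReal) ⁻¹' Iic t = ∅ := by
      ext s
      simpa using ht.trans_le ENNReal.toReal_nonneg
    have h2 : Iic t ∩ Ioc 0 M = ∅ := by
      ext s
      simp only [mem_inter_iff, mem_Iic, mem_Ioc, mem_empty_iff_false, iff_false]
      rintro ⟨h, h', -⟩
      linarith
    rw [h1, h2]
    simp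
  rcases le_or_gt M t with hMt | hMt
  · have h2 : Iic t ∩ Ioc 0 M = Ioc 0 M :=
      inter_eq_self_of_subset_right fun s hs => hs.2.trans hMt
    rw [h2, Real.volume_Ioc, sub_zero, ← hνuniv]
    refine measure_congr ?_
    filter_upwards [hae] with s hs
    refine propext ⟨fun _ => trivial, fun _ => ?_⟩
    exact (ENNReal.toReal_mono hfin (monotone_cumulative u a hs.2.le)).trans hMt
  have h2 : Iic t ∩ Ioc 0 M = Ioc 0 t := by
    ext s
    simp only [mem_inter_iff, mem_Iic, mem_Ioc]
    constructor
    · rintro ⟨h, h', -⟩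
      exact ⟨h', h⟩
    · rintro ⟨h, h'⟩
      exact ⟨h', h, h'.trans hMt.le⟩
  rw [h2, Real.volume_Ioc, sub_zero]
  -- The cumulative hazard is constant wherever `u` vanishes, so its sublevel set need not be an
  -- interval ending at a chosen `σ`. It lies in `Ioo a σ` when `σ` has level `t' > t`, and then
  -- `t'` decreases to `t`; it contains `Ioo a σ` when `σ` has level `t`.
  refine le_antisymm ?_ ?_
  · have hlim : Tendsto ENNReal.ofReal (𝓝[>] t) (𝓝 (ENNReal.ofReal t)) :=
      (ENNReal.continuous_ofReal.tendsto t).mono_left nhdsWithin_le_nhds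
    refine ge_of_tendsto hlim ?_
    filter_upwards [Ioo_mem_nhdsGT hMt] with t' ht'
    obtain ⟨σ, hσ, hσt⟩ := exists_cumulative_eq hu har hfin (ht.trans ht'.1.le) ht'.2.le
    rw [← hσt, ← hν σ hσ]
    refine measure_mono_ae ?_
    filter_upwards [hae] with s hs hst
    refine ⟨hs.1, not_le.1 fun hle => ?_⟩
    have h3 : (∫⁻ x in Ioo a σ, u x).toReal ≤ t :=
      (ENNReal.toReal_mono (hfin' s ⟨hs.1.le, hs.2.le⟩) (monotone_cumulative u a hle)).trans hst
    rw [hσt, ENNReal.toReal_ofReal (ht.trans ht'.1.le)] at h3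
    exact absurd ht'.1 (not_lt.2 h3)
  · obtain ⟨σ, hσ, hσt⟩ := exists_cumulative_eq hu har hfin ht hMt.le
    rw [← hσt, ← hν σ hσ]
    refine measure_mono fun s hs => ?_
    have h3 := ENNReal.toReal_mono (hfin' σ hσ) (monotone_cumulative u a hs.2.le)
    rwa [hσt, ENNReal.toReal_ofReal ht] at h3

/-- Pushed forward by the cumulative hazard, the left side is the integral of `exp (-x)` over `(0,
M]`, where `M` is the total hazard. -/
lemma lintegral_hazard_mul_expNeg {u : ℝ → ℝ≥0∞} (hu : Measurable u) {a r : ℝ}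
    (hfin : ∫⁻ x in Ioo a r, u x ≠ ∞) :
    ∫⁻ s in Ioo a r, u s * expNeg (∫⁻ x in Ioo a s, u x) =
      1 - expNeg (∫⁻ x in Ioo a r, u x) := by
  rcases le_or_gt a r with har | har
  swap
  · simp [Ioo_eq_empty (not_lt.2 har.le), expNeg_zero]
  have hmeas : Measurable fun s => (∫⁻ x in Ioo a s, u x).toReal :=
    (monotone_cumulative u a).measurable.ennreal_toReal
  have hE : Measurable fun s => expNeg (∫⁻ x in Ioo a s, u x) :=
    measurable_expNeg.comp (monotone_cumulative u a).measurable
  have h1 := lintegral_withDensity_eq_lintegral_mul (volume.restrict (Ioo a r)) hu hE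
  simp only [Pi.mul_apply] at h1
  have h2 : Measurable fun x : ℝ => ENNReal.ofReal (Real.exp (-x)) := by fun_prop
  have h3 := lintegral_map (μ := (volume.restrict (Ioo a r)).withDensity u) h2 hmeas
  rw [map_cumulative hu har hfin, lintegral_exp_neg_Ioc ENNReal.toReal_nonneg] at h3
  rw [← h1, one_sub_expNeg, h3]
  rfl

/-! ### Random distances with a given survival function -/

section Survival

variable {Ω : Type*} [MeasurableSpace Ω] {μ : Measure Ω} {R : Ω → ℝ≥0∞} {u : ℝ → ℝ≥0∞}

/-- The event `R = ∞` lies in every event `r ≤ R`, whose probability is arbitrarily small because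
the cumulative hazard is unbounded. -/
lemma ae_ne_top_of_survival
    (hsurv : ∀ r : ℝ, 0 ≤ r → μ {ω | ENNReal.ofReal r ≤ R ω} = expNeg (∫⁻ x in Ioo 0 r, u x))
    (hlim : ∀ M : ℝ, ∃ r : ℝ, 0 ≤ r ∧ M ≤ (∫⁻ x in Ioo 0 r, u x).toReal) :
    ∀ᵐ ω ∂μ, R ω ≠ ∞ := by
  have hle : ∀ M : ℝ, μ {ω | ¬ R ω ≠ ∞} ≤ ENNReal.ofReal (Real.exp (-M)) := by
    intro M
    obtain ⟨r, hr, hMr⟩ := hlim M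
    calc μ {ω | ¬ R ω ≠ ∞} ≤ μ {ω | ENNReal.ofReal r ≤ R ω} :=
          measure_mono fun ω hω => by
            simp only [ne_eq, not_not, mem_ofPred_eq] at hω
            simp [hω]
      _ = expNeg (∫⁻ x in Ioo 0 r, u x) := hsurv r hr
      _ ≤ _ := ENNReal.ofReal_le_ofReal (Real.exp_le_exp.2 (neg_le_neg hMr))
  have ht : Tendsto (fun M : ℝ => ENNReal.ofReal (Real.exp (-M))) atTop (𝓝 0) := by
    have := ENNReal.tendsto_ofReal (Real.tendsto_exp_neg_atTop_nhds_zero)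
    simpa using this
  exact le_antisymm (ge_of_tendsto' ht hle) (zero_le)

/-- Both measures give `Iio b` the mass `1 - exp (-∫_0^b u)`, hence agree on half-open intervals. -/
lemma map_toReal_eq_withDensity [IsProbabilityMeasure μ] (hR : Measurable R) (hu : Measurable u)
    (hfin : ∀ r, ∫⁻ x in Ioo 0 r, u x ≠ ∞)
    (hsurv : ∀ r : ℝ, 0 ≤ r → μ {ω | ENNReal.ofReal r ≤ R ω} = expNeg (∫⁻ x in Ioo 0 r, u x))
    (hlim : ∀ M : ℝ, ∃ r : ℝ, 0 ≤ r ∧ M ≤ (∫⁻ x in Ioo 0 r, u x).toReal) :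
    μ.map (fun ω => (R ω).toReal) =
      volume.withDensity fun r => if r ≤ 0 then 0 else u r * expNeg (∫⁻ x in Ioo 0 r, u x) := by
  have hae := ae_ne_top_of_survival hsurv hlim
  have hD : ∀ b, (volume.withDensity fun r => if r ≤ 0 then 0 else
      u r * expNeg (∫⁻ x in Ioo 0 r, u x)) (Iio b) = 1 - expNeg (∫⁻ x in Ioo 0 b, u x) := by
    intro b
    rw [withDensity_apply _ measurableSet_Iio, ← lintegral_hazard_mul_expNeg hu (hfin b),
      ← lintegral_indicator measurableSet_Iio, ← lintegral_indicator measurableSet_Ioo]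
    refine lintegral_congr fun r => ?_
    by_cases h1 : r < b <;> by_cases h2 : 0 < r <;> simp [indicator, h1, h2]
  have hM : ∀ b, (μ.map fun ω => (R ω).toReal) (Iio b) = 1 - expNeg (∫⁻ x in Ioo 0 b, u x) := by
    intro b
    rw [Measure.map_apply hR.ennreal_toReal measurableSet_Iio]
    rcases le_or_gt b 0 with hb | hb
    · have h1 : (fun ω => (R ω).toReal) ⁻¹' Iio b = ∅ := by
        ext ω
        simpa using hb.trans ENNReal.toReal_nonneg
      simp [h1, Ioo_eq_empty (not_lt.2 hb), expNeg_zero]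
    -- Where `R = ∞`, `toReal` is `0 < b` although `b ≤ R`; the two events are complementary only
    -- off this null set.
    · have hms : MeasurableSet {ω | ENNReal.ofReal b ≤ R ω} := measurableSet_le measurable_const hR
      rw [← hsurv b hb.le, ← prob_compl_eq_one_sub hms]
      refine measure_congr ?_
      filter_upwards [hae] with ω hω
      refine propext ?_
      change (R ω).toReal < b ↔ ¬ (ENNReal.ofReal b ≤ R ω)
      rw [ENNReal.ofReal_le_iff_le_toReal hω, not_le]
  have : IsProbabilityMeasure (μ.map fun ω => (R ω).toReal) :=
    Measure.isProbabilityMeasure_map hR.ennreal_toReal.aemeasurable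
  refine Measure.ext_of_Ico _ _ fun a b hab => ?_
  have hIco : Ico a b = Iio b \ Iio a := by
    ext x
    simp
  have hfinD : (volume.withDensity fun r => if r ≤ 0 then 0 else
      u r * expNeg (∫⁻ x in Ioo 0 r, u x)) (Iio a) ≠ ∞ := by
    rw [hD]
    exact ne_top_of_le_ne_top ENNReal.one_ne_top tsub_le_self
  rw [hIco, measure_sdiff (Iio_subset_Iio hab.le) measurableSet_Iio.nullMeasurableSet
      (measure_ne_top _ _), measure_sdiff (Iio_subset_Iio hab.le)
      measurableSet_Iio.nullMeasurableSet hfinD, hM, hM, hD, hD]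

/-- The complement of `r ≤ R` is `R < r`; the atom `R = r` that separates it from `R ≤ r` is null
because the law has a density. -/
lemma measure_le_eq_of_survival [IsProbabilityMeasure μ] (hR : Measurable R) (hu : Measurable u)
    (hfin : ∀ r, ∫⁻ x in Ioo 0 r, u x ≠ ∞)
    (hsurv : ∀ r : ℝ, 0 ≤ r → μ {ω | ENNReal.ofReal r ≤ R ω} = expNeg (∫⁻ x in Ioo 0 r, u x))
    (hlim : ∀ M : ℝ, ∃ r : ℝ, 0 ≤ r ∧ M ≤ (∫⁻ x in Ioo 0 r, u x).toReal) {r : ℝ} (hr : 0 ≤ r) :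
    μ {ω | R ω ≤ ENNReal.ofReal r} = 1 - expNeg (∫⁻ x in Ioo 0 r, u x) := by
  have hae := ae_ne_top_of_survival hsurv hlim
  have hmap := map_toReal_eq_withDensity hR hu hfin hsurv hlim
  have hms : MeasurableSet {ω | ENNReal.ofReal r ≤ R ω} := measurableSet_le measurable_const hR
  rw [← hsurv r hr, ← prob_compl_eq_one_sub hms]
  have h0 : μ ((fun ω => (R ω).toReal) ⁻¹' {r}) = 0 := by
    rw [← Measure.map_apply hR.ennreal_toReal (measurableSet_singleton r), hmap]
    exact withDensity_absolutelyContinuous _ _ (measure_singleton r)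
  refine measure_congr ?_
  filter_upwards [hae, measure_eq_zero_iff_ae_notMem.1 h0] with ω hω hne
  refine propext ?_
  change R ω ≤ ENNReal.ofReal r ↔ ¬ (ENNReal.ofReal r ≤ R ω)
  rw [ENNReal.ofReal_le_iff_le_toReal hω, not_le, ENNReal.le_ofReal_iff_toReal_le hω hr]
  exact ⟨fun h => lt_of_le_of_ne h hne, le_of_lt⟩

end Survival

/-! ### Infinite products of weights at most one -/

/-- The product of all the weights `a 0, a 1, …`, for weights that are at most `1`. -/
def infProd (a : ℕ → ℝ≥0∞) : ℝ≥0∞ := ⨅ n : ℕ, ∏ i ∈ Finset.range n, a i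

lemma antitone_prod_range {a : ℕ → ℝ≥0∞} (ha : ∀ i, a i ≤ 1) :
    Antitone fun n : ℕ => ∏ i ∈ Finset.range n, a i := by
  refine antitone_nat_of_succ_le fun n => ?_
  rw [Finset.prod_range_succ]
  exact mul_le_of_le_one_right' (ha n)

lemma infProd_le_one (a : ℕ → ℝ≥0∞) : infProd a ≤ 1 :=
  (iInf_le _ 0).trans (by simp)

lemma infProd_mono {a b : ℕ → ℝ≥0∞} (h : ∀ i, a i ≤ b i) : infProd a ≤ infProd b :=
  iInf_mono fun _ => Finset.prod_le_prod' fun i _ => h i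

lemma measurable_infProd {α : Type*} [MeasurableSpace α] {a : ℕ → α → ℝ≥0∞}
    (ha : ∀ i, Measurable (a i)) : Measurable fun x => infProd fun i => a i x :=
  Measurable.iInf fun _ => Finset.measurable_prod _ fun i _ => ha i

/-- Both sides are limits of the same decreasing sequence; the bound by `1` excludes the
discontinuity of multiplication at `0 * ∞`. -/
lemma prod_iInf_of_antitone {ι : Type*} (s : Finset ι) {a : ι → ℕ → ℝ≥0∞}
    (hanti : ∀ i ∈ s, Antitone (a i)) (hone : ∀ i ∈ s, ∀ n, a i n ≤ 1) :
    ⨅ n, ∏ i ∈ s, a i n = ∏ i ∈ s, ⨅ n, a i n := by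
  have h1 : Antitone fun n => ∏ i ∈ s, a i n := fun m n hmn =>
    Finset.prod_le_prod' fun i hi => hanti i hi hmn
  refine tendsto_nhds_unique (tendsto_atTop_iInf h1) ?_
  refine ENNReal.tendsto_finsetProd_of_ne_top s (fun i hi => tendsto_atTop_iInf (hanti i hi))
    fun i hi => ?_
  exact ne_top_of_le_ne_top ENNReal.one_ne_top ((iInf_le _ 0).trans (hone i hi 0))

lemma prod_infProd {ι : Type*} (s : Finset ι) {a : ι → ℕ → ℝ≥0∞} (ha : ∀ i ∈ s, ∀ n, a i n ≤ 1) :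
    ∏ i ∈ s, infProd (a i) = infProd fun n => ∏ i ∈ s, a i n := by
  unfold infProd
  rw [← prod_iInf_of_antitone s (fun i hi => antitone_prod_range (ha i hi))
    fun i hi n => Finset.prod_le_one' fun j _ => ha i hi j]
  exact iInf_congr fun n => Finset.prod_comm

lemma iInf_infProd {a : ℕ → ℕ → ℝ≥0∞} (hanti : ∀ i, Antitone fun m => a m i)
    (ha : ∀ m i, a m i ≤ 1) : ⨅ m, infProd (a m) = infProd fun i => ⨅ m, a m i := by
  unfold infProd
  rw [iInf_comm]
  exact iInf_congr fun n => prod_iInf_of_antitone (a := fun i m => a m i) _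
    (fun i _ => hanti i) fun i _ m => ha m i

/-! ### The number of points in a set -/

/-- `q ^ N` for an extended natural number `N` and a weight `q ≤ 1`. -/
def powENat (q : ℝ≥0∞) (N : ℕ∞) : ℝ≥0∞ := ⨅ (n : ℕ) (_ : (n : ℕ∞) ≤ N), q ^ n

lemma powENat_natCast {q : ℝ≥0∞} (hq : q ≤ 1) (n : ℕ) : powENat q n = q ^ n := by
  refine le_antisymm (iInf₂_le (f := fun (m : ℕ) (_ : (m : ℕ∞) ≤ n) => q ^ m) n le_rfl)
    (le_iInf₂ fun m hm => ?_)
  exact pow_le_pow_right_of_le_one' hq (by exact_mod_cast hm)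

section Count

variable {Ω : Type*} {E : Type*} {X : ℕ → Ω → E} {B : Set E}

open Classical in
-- The `n`-th partial product is `q` to the number of the first `n` points in `B`. Any `k` points of
-- `B` occur in some initial segment, so the two infima agree even when the count is infinite.
lemma infProd_indicator_eq_powENat {q : ℝ≥0∞} (hq : q ≤ 1) (ω : Ω) :
    (infProd fun i => if X i ω ∈ B then q else 1) = powENat q (pointCount X B ω) := by
  have hprod : ∀ n : ℕ, ∏ i ∈ Finset.range n, (if X i ω ∈ B then q else 1) =
      q ^ ((Finset.range n).filter fun i => X i ω ∈ B).card := by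
    intro n
    rw [Finset.prod_ite]
    simp
  unfold infProd powENat
  simp_rw [hprod]
  refine le_antisymm (le_iInf₂ fun k hk => ?_) (le_iInf fun n => ?_)
  · obtain ⟨t, ht, htk⟩ := exists_subset_encard_eq hk
    have htf : t.Finite := finite_of_encard_eq_coe htk
    obtain ⟨n, hn⟩ := htf.bddAbove
    refine (iInf_le _ (n + 1)).trans (pow_le_pow_right_of_le_one' hq ?_)
    have h1 : htf.toFinset ⊆ (Finset.range (n + 1)).filter fun i => X i ω ∈ B := by
      intro i hi
      rw [Finite.mem_toFinset] at hi
      simp only [Finset.mem_filter, Finset.mem_range]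
      exact ⟨Nat.lt_succ_of_le (hn hi), ht hi⟩
    have h2 := Finset.card_le_card h1
    rwa [← ncard_eq_toFinset_card _ htf, ncard_def, htk, ENat.toNat_natCast] at h2
  · refine iInf₂_le _ ?_
    rw [← encard_coe_eq_coe_finsetCard]
    exact encard_le_encard fun i hi => by simpa using (Finset.mem_filter.1 hi).2

open Classical in
lemma pointCount_eq_iSup (ω : Ω) :
    pointCount X B ω = ⨆ n : ℕ, (∑ i ∈ Finset.range n, if X i ω ∈ B then (1 : ℕ∞) else 0) := by
  have hsum : ∀ n : ℕ, (∑ i ∈ Finset.range n, if X i ω ∈ B then (1 : ℕ∞) else 0) =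
      (((Finset.range n).filter fun i => X i ω ∈ B).card : ℕ∞) := by
    intro n
    simp
  simp_rw [hsum]
  refine le_antisymm ?_ (iSup_le fun n => ?_)
  · refine ENat.forall_natCast_le_iff_le.1 fun k hk => ?_
    obtain ⟨t, ht, htk⟩ := exists_subset_encard_eq hk
    have htf : t.Finite := finite_of_encard_eq_coe htk
    obtain ⟨n, hn⟩ := htf.bddAbove
    refine le_trans ?_ (le_iSup _ (n + 1))
    rw [← htk, ← encard_coe_eq_coe_finsetCard]
    refine encard_le_encard fun i hi => ?_
    simp only [Finset.coe_filter, Finset.mem_range, mem_ofPred_eq]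
    exact ⟨Nat.lt_succ_of_le (hn hi), ht hi⟩
  · rw [← encard_coe_eq_coe_finsetCard]
    exact encard_le_encard fun i hi => by simpa using (Finset.mem_filter.1 hi).2

/-- The count is a supremum of finite sums of indicators, so its sublevel sets are measurable;
fibres are countable combinations of these. -/
lemma measurable_pointCount [MeasurableSpace Ω] [MeasurableSpace E] (hX : ∀ i, Measurable (X i))
    (hB : MeasurableSet B) : Measurable (pointCount X B) := by
  classical
  have : pointCount X B = fun ω =>
      ⨆ n : ℕ, (∑ i ∈ Finset.range n, if X i ω ∈ B then (1 : ℕ∞) else 0) :=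
    funext fun ω => pointCount_eq_iSup ω
  rw [this]
  have hc : ∀ n : ℕ, Measurable fun ω =>
      ∑ i ∈ Finset.range n, if X i ω ∈ B then (1 : ℕ∞) else 0 := by
    intro n
    induction n with
    | zero => simp
    | succ n ih =>
      simp only [Finset.sum_range_succ]
      have h1 : Measurable fun ω => if X n ω ∈ B then (1 : ℕ∞) else 0 :=
        Measurable.ite (hX n hB) measurable_const measurable_const
      exact (Measurable.of_discrete (f := fun x : ℕ∞ × ℕ∞ => x.1 + x.2)).comp (ih.prodMk h1)
  have hle : ∀ y : ℕ∞, MeasurableSet {ω | ⨆ n : ℕ,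
      (∑ i ∈ Finset.range n, if X i ω ∈ B then (1 : ℕ∞) else 0) ≤ y} := by
    intro y
    simp only [iSup_le_iff, ofPred_forall]
    exact MeasurableSet.iInter fun n => hc n (.of_discrete (s := {z | z ≤ y}))
  refine measurable_to_countable' fun x => ?_
  convert (hle x).diff (MeasurableSet.biUnion (to_countable {y | y < x}) fun y _ => hle y) using 1
  ext ω
  simp only [mem_preimage, mem_singleton_iff, Set.mem_sdiff, mem_ofPred_eq, mem_iUnion, exists_prop,
    not_exists, not_and, not_le]
  exact ⟨fun h => ⟨h.le, fun y hy => h ▸ hy⟩, fun ⟨h, h'⟩ => le_antisymm h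
    (not_lt.1 fun hlt => lt_irrefl _ (h' _ hlt))⟩

end Count

lemma hasSum_pow_mul_poisson (x q : ℝ) :
    HasSum (fun n : ℕ => q ^ n * (Real.exp (-x) * x ^ n / n.factorial))
      (Real.exp (-((1 - q) * x))) := by
  have h := (NormedSpace.expSeries_div_hasSum_exp (𝔸 := ℝ) (q * x)).mul_left (Real.exp (-x))
  rw [← Real.exp_eq_exp_ℝ, ← Real.exp_add] at h
  have h1 : -x + q * x = -((1 - q) * x) := by ring
  rw [h1] at h
  refine h.congr_fun fun n => ?_
  rw [mul_pow]
  ring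

lemma lintegral_pow_poissonMeasure (x : NNReal) {q : ℝ≥0∞} (hq : q ≤ 1) :
    ∫⁻ n, q ^ n ∂(poissonMeasure x) = expNeg ((1 - q) * x) := by
  have hq' : q ≠ ∞ := ne_top_of_le_ne_top ENNReal.one_ne_top hq
  lift q to NNReal using hq'
  rw [lintegral_countable']
  have h := hasSum_pow_mul_poisson (x : ℝ) (q : ℝ)
  have h2 : ((1 - (q : ℝ≥0∞)) * x).toReal = (1 - (q : ℝ)) * x := by
    rw [ENNReal.toReal_mul, ENNReal.toReal_sub_of_le hq ENNReal.one_ne_top]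
    simp
  rw [expNeg, h2, ← h.tsum_eq, ENNReal.ofReal_tsum_of_nonneg (fun n => by positivity) h.summable]
  congr 1
  funext n
  rw [poissonMeasure_singleton, ENNReal.ofReal_mul (by positivity),
    ENNReal.ofReal_pow (by positivity), ENNReal.ofReal_coe_nnreal]

/-! ### Probability generating functional of a Poisson process -/

section PPP

variable {Ω : Type*} [MeasurableSpace Ω] {μ : Measure Ω} [IsProbabilityMeasure μ]
  {E : Type*} [MeasurableSpace E] {X : ℕ → Ω → E} {Λ : Measure E}

/-- The definition prescribes the masses at finite counts only; the mass at `⊤` is what they leave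
of total mass `1`, the same on both sides. -/
lemma IsPPP.map_pointCount (hX : IsPPP X Λ μ) {B : Set E} (hB : MeasurableSet B)
    (hΛ : Λ B ≠ ∞) :
    μ.map (pointCount X B) = (poissonMeasure (Λ B).toNNReal).map (Nat.cast : ℕ → ℕ∞) := by
  have hm := measurable_pointCount hX.measurable hB
  have : IsProbabilityMeasure (μ.map (pointCount X B)) :=
    Measure.isProbabilityMeasure_map hm.aemeasurable
  have hcast : Measurable (Nat.cast : ℕ → ℕ∞) := Measurable.of_discrete
  have : IsProbabilityMeasure ((poissonMeasure (Λ B).toNNReal).map (Nat.cast : ℕ → ℕ∞)) :=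
    Measure.isProbabilityMeasure_map hcast.aemeasurable
  have hnat : ∀ n : ℕ, μ.map (pointCount X B) {(n : ℕ∞)} =
      (poissonMeasure (Λ B).toNNReal).map (Nat.cast : ℕ → ℕ∞) {(n : ℕ∞)} := by
    intro n
    rw [Measure.map_apply hm (measurableSet_singleton _),
      Measure.map_apply hcast (measurableSet_singleton _)]
    have h1 : (Nat.cast : ℕ → ℕ∞) ⁻¹' {(n : ℕ∞)} = {n} := by
      ext k
      simp
    rw [h1, ← hX.poisson B hB hΛ n]
    rfl
  have htop : ∀ ν : Measure ℕ∞, IsProbabilityMeasure ν → ν {⊤} = 1 - ∑' n : ℕ, ν {(n : ℕ∞)} := by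
    intro ν _
    have h1 : ({⊤} : Set ℕ∞)ᶜ = ⋃ n : ℕ, {(n : ℕ∞)} := by
      ext x
      simp only [mem_compl_iff, mem_singleton_iff, mem_iUnion]
      rw [← ne_eq, ENat.ne_top_iff_exists]
      exact ⟨fun ⟨n, h⟩ => ⟨n, h.symm⟩, fun ⟨n, h⟩ => ⟨n, h.symm⟩⟩
    have h2 := prob_compl_eq_one_sub (μ := ν) (measurableSet_singleton (⊤ : ℕ∞)).compl
    rw [compl_compl] at h2
    rw [h2, h1, measure_iUnion _ fun _ => measurableSet_singleton _]
    intro m n hmn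
    simpa using hmn
  refine Measure.ext_of_singleton fun x => ?_
  induction x using ENat.recTopCoe with
  | top => rw [htop _ inferInstance, htop _ inferInstance]; simp_rw [hnat]
  | coe n => exact hnat n

lemma IsPPP.lintegral_powENat (hX : IsPPP X Λ μ) {B : Set E} (hB : MeasurableSet B)
    (hΛ : Λ B ≠ ∞) {q : ℝ≥0∞} (hq : q ≤ 1) :
    ∫⁻ ω, powENat q (pointCount X B ω) ∂μ = expNeg ((1 - q) * Λ B) := by
  have hm := measurable_pointCount hX.measurable hB
  have hcast : Measurable (Nat.cast : ℕ → ℕ∞) := Measurable.of_discrete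
  rw [← lintegral_map (f := powENat q) Measurable.of_discrete hm, hX.map_pointCount hB hΛ,
    lintegral_map Measurable.of_discrete hcast]
  simp_rw [powENat_natCast hq]
  rw [lintegral_pow_poissonMeasure _ hq, ENNReal.coe_toNNReal hΛ]

/-- The probability generating functional of a Poisson point process, for simple functions. -/
lemma IsPPP.lintegral_infProd_simpleFunc (hX : IsPPP X Λ μ) (g : SimpleFunc E ℝ≥0∞)
    (hg : ∀ x, g x ≤ 1) (hΛ : Λ {x | g x ≠ 1} ≠ ∞) :
    ∫⁻ ω, infProd (fun i => g (X i ω)) ∂μ = expNeg (∫⁻ x, (1 - g x) ∂Λ) := by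
  classical
  -- The value `1` is left out: its level set may have infinite intensity, and it contributes only
  -- factors `1`. The other level sets are disjoint with finite intensity, so their counts are
  -- independent Poisson variables.
  set V := g.range.filter (· ≠ 1) with hV
  set B : V → Set E := fun v => g ⁻¹' {(v : ℝ≥0∞)} with hB
  have hBm : ∀ v, MeasurableSet (B v) := fun v => g.measurableSet_fiber _
  have hBΛ : ∀ v, Λ (B v) ≠ ∞ := by
    intro v
    refine ne_top_of_le_ne_top hΛ (measure_mono fun x hx => ?_)
    have hx' : g x = v := hx
    simpa [hx'] using (Finset.mem_filter.1 v.2).2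
  have hv : ∀ v : V, (v : ℝ≥0∞) ≤ 1 := by
    intro v
    obtain ⟨x, hx⟩ := SimpleFunc.mem_range.1 (Finset.mem_filter.1 v.2).1
    rw [← hx]
    exact hg x
  have hdisj : Pairwise fun v w => Disjoint (B v) (B w) := by
    intro v w hvw
    refine Set.disjoint_left.2 fun x hx hx' => hvw (Subtype.ext ?_)
    exact (show g x = v from hx).symm.trans hx'
  have hindep : iIndepFun (fun v => pointCount X (B v)) μ := by
    have h1 := hX.indep (Fintype.card V) (fun k => B ((Fintype.equivFin V).symm k))
      (fun k => hBm _) (fun k => hBΛ _) fun k l hkl => hdisj (by simpa using hkl)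
    simpa using h1.precomp (Fintype.equivFin V).injective
  have hprod : ∀ x, g x = ∏ v : V, if x ∈ B v then (v : ℝ≥0∞) else 1 := by
    intro x
    by_cases hx : g x = 1
    · rw [hx, Finset.prod_eq_one]
      intro v _
      rw [if_neg]
      intro hxv
      exact (Finset.mem_filter.1 v.2).2 ((show g x = v from hxv).symm.trans hx)
    · have hmem : g x ∈ V := Finset.mem_filter.2 ⟨g.mem_range_self x, hx⟩
      rw [Finset.prod_eq_single (⟨g x, hmem⟩ : V)]
      · rw [if_pos (show x ∈ B ⟨g x, hmem⟩ from rfl)]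
      · intro w _ hw
        rw [if_neg]
        intro hxw
        exact hw (Subtype.ext (show g x = w from hxw).symm)
      · simp
  have hpt : ∀ ω, infProd (fun i => g (X i ω)) =
      ∏ v : V, (powENat (v : ℝ≥0∞) ∘ pointCount X (B v)) ω := by
    intro ω
    simp only [Function.comp_apply]
    simp_rw [fun v : V => (infProd_indicator_eq_powENat (X := X) (B := B v) (hv v) ω).symm]
    rw [prod_infProd]
    · congr 1
      funext i
      exact hprod _
    · intro v _ n
      split_ifs
      · exact hv v
      · exact le_rfl
  simp_rw [hpt]
  rw [lintegral_prod_eq_prod_lintegral_of_indepFun Finset.univ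
    (fun v : V => powENat (v : ℝ≥0∞) ∘ pointCount X (B v))
    (hindep.comp _ fun v => Measurable.of_discrete)
    fun v => Measurable.of_discrete.comp (measurable_pointCount hX.measurable (hBm v))]
  simp only [Function.comp_apply]
  simp_rw [fun v : V => hX.lintegral_powENat (hBm v) (hBΛ v) (hv v)]
  rw [expNeg_sum _ _ fun v _ => ENNReal.mul_ne_top
    (ne_top_of_le_ne_top ENNReal.one_ne_top tsub_le_self) (hBΛ v)]
  congr 1
  have h1 := SimpleFunc.map_lintegral (μ := Λ) (fun y : ℝ≥0∞ => 1 - y) g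
  have h2 := SimpleFunc.lintegral_eq_lintegral (g.map fun y : ℝ≥0∞ => 1 - y) Λ
  simp only [SimpleFunc.map_apply] at h2
  rw [h2, h1, Finset.sum_coe_sort V (fun v => (1 - v) * Λ (g ⁻¹' {v})), hV, Finset.sum_filter]
  refine Finset.sum_congr rfl fun v _ => ?_
  by_cases h : v = 1 <;> simp [h]

/-- The probability generating functional of a Poisson point process. -/
theorem IsPPP.lintegral_infProd (hX : IsPPP X Λ μ) {g : E → ℝ≥0∞} (hg : Measurable g)
    (hg1 : ∀ x, g x ≤ 1) (hΛ : Λ {x | g x ≠ 1} ≠ ∞) :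
    ∫⁻ ω, infProd (fun i => g (X i ω)) ∂μ = expNeg (∫⁻ x, (1 - g x) ∂Λ) := by
  have hf : Measurable fun x => 1 - g x := measurable_const.sub hg
  -- Approximating `1 - g` from below makes the simple weights `1 - φ m` decrease to `g` and equal
  -- `1` wherever `g` does, so the finite-intensity condition is inherited.
  set φ := SimpleFunc.eapprox fun x => 1 - g x with hφ
  set ψ : ℕ → SimpleFunc E ℝ≥0∞ := fun m => (φ m).map fun y => 1 - y with hψ
  have hψapp : ∀ m x, ψ m x = 1 - φ m x := fun m x => rfl
  have hφle : ∀ m x, φ m x ≤ 1 - g x := by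
    intro m x
    rw [← SimpleFunc.iSup_eapprox_apply hf x]
    exact le_iSup (fun n => φ n x) m
  have hψ1 : ∀ m x, ψ m x ≤ 1 := fun m x => tsub_le_self
  have hψanti : ∀ x, Antitone fun m => ψ m x := by
    intro x m n hmn
    exact tsub_le_tsub_left (SimpleFunc.monotone_eapprox (fun x => 1 - g x) hmn x) 1
  have hsub : ∀ m x, 1 - ψ m x = φ m x := by
    intro m x
    rw [hψapp, ENNReal.sub_sub_cancel ENNReal.one_ne_top ((hφle m x).trans tsub_le_self)]
  have hψinf : ∀ x, ⨅ m, ψ m x = g x := by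
    intro x
    simp_rw [hψapp]
    rw [← ENNReal.sub_iSup ENNReal.one_ne_top, SimpleFunc.iSup_eapprox_apply hf x,
      ENNReal.sub_sub_cancel ENNReal.one_ne_top (hg1 x)]
  have hm : ∀ m, ∫⁻ ω, infProd (fun i => ψ m (X i ω)) ∂μ = expNeg (∫⁻ x, φ m x ∂Λ) := by
    intro m
    rw [hX.lintegral_infProd_simpleFunc (ψ m) (hψ1 m)]
    · simp_rw [hsub]
    · refine ne_top_of_le_ne_top hΛ (measure_mono fun x hx h => hx ?_)
      have := hφle m x
      rw [h] at this
      rw [hψapp, nonpos_iff_eq_zero.1 (this.trans_eq (tsub_self _)), tsub_zero]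
  have hfin : ∫⁻ x, (1 - g x) ∂Λ ≠ ∞ := by
    refine ne_top_of_le_ne_top hΛ ?_
    have hset : MeasurableSet {x | g x ≠ 1} := (hg (measurableSet_singleton 1)).compl
    rw [← lintegral_indicator_one hset]
    refine lintegral_mono fun x => ?_
    by_cases h : g x = 1
    · simp [h]
    · rw [indicator_of_mem (show x ∈ {x | g x ≠ 1} from h)]
      exact tsub_le_self
  have hanti : Antitone fun m ω => infProd fun i => ψ m (X i ω) := fun m n hmn ω =>
    infProd_mono fun i => hψanti _ hmn
  have hmeas : ∀ m, Measurable fun ω => infProd fun i => ψ m (X i ω) := fun m =>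
    measurable_infProd fun i => (ψ m).measurable.comp (hX.measurable i)
  have hlim : Tendsto (fun m => ∫⁻ x, φ m x ∂Λ) atTop (𝓝 (∫⁻ x, (1 - g x) ∂Λ)) :=
    lintegral_tendsto_of_tendsto_of_monotone (fun m => (φ m).measurable.aemeasurable)
      (Eventually.of_forall fun x m n hmn =>
        SimpleFunc.monotone_eapprox (fun x => 1 - g x) hmn x)
      (Eventually.of_forall fun x => SimpleFunc.tendsto_eapprox hf x)
  -- Uses `hfin`: passage to `toReal` is continuous only at a finite limit.
  have hlim' : Tendsto (fun m => expNeg (∫⁻ x, φ m x ∂Λ)) atTop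
      (𝓝 (expNeg (∫⁻ x, (1 - g x) ∂Λ))) :=
    ENNReal.tendsto_ofReal ((Real.continuous_exp.tendsto _).comp
      (((ENNReal.tendsto_toReal hfin).comp hlim).neg))
  refine tendsto_nhds_unique ?_ hlim'
  simp_rw [← hm]
  have h1 : ∀ ω, infProd (fun i => g (X i ω)) = ⨅ m, infProd fun i => ψ m (X i ω) := by
    intro ω
    rw [iInf_infProd (fun i => hψanti _) fun m i => hψ1 m _]
    simp_rw [hψinf]
  simp_rw [h1]
  rw [lintegral_iInf hmeas hanti]
  · exact tendsto_atTop_iInf fun m n hmn => lintegral_mono (hanti hmn)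
  · rw [hm]
    exact expNeg_ne_top _

end PPP

/-! ### Independent marks -/

section Marking

variable {Ω : Type*} [MeasurableSpace Ω] {μ : Measure Ω} [IsProbabilityMeasure μ]
  {ι : Type*} {X : ι → Ω → Plane} {S : ι → Set Ω} {p : ℝ → ℝ}

/-- Inclusion-exclusion, one index at a time. The marking axiom concerns intersections of the `S i`
only; forbidding a further mark subtracts an event in which that index moves from `I` to `J` and `A`
shrinks, so the induction must keep `J` and `A` general. -/
lemma IsLoSMarking.measure_inter_forall (hS : IsLoSMarking X S p μ) (hX : ∀ i, Measurable (X i))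
    (hp : Measurable p) (hp1 : ∀ x, p x ≤ 1) {B : Set Plane} (hB : MeasurableSet B)
    (I : Finset ι) : ∀ (J : Finset ι) (A : Set (ι → Plane)), Disjoint I J → MeasurableSet A →
    μ (({ω | (fun i => X i ω) ∈ A} ∩ ⋂ i ∈ J, S i) ∩ {ω | ∀ i ∈ I, X i ω ∈ B → ω ∉ S i}) =
      ∫⁻ ω in {ω | (fun i => X i ω) ∈ A}, (∏ i ∈ J, ENNReal.ofReal (p ‖X i ω‖)) *
        ∏ i ∈ I, (1 - B.indicator (fun x => ENNReal.ofReal (p ‖x‖)) (X i ω)) ∂μ := by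
  classical
  have hXm : Measurable fun ω i => X i ω := measurable_pi_lambda _ hX
  have hq : Measurable fun x : Plane => ENNReal.ofReal (p ‖x‖) :=
    (hp.comp measurable_norm).ennreal_ofReal
  have hq1 : ∀ x : Plane, B.indicator (fun x => ENNReal.ofReal (p ‖x‖)) x ≤ 1 := by
    intro x
    refine (indicator_le_self _ _ x).trans ?_
    rw [ENNReal.ofReal_le_one]
    exact hp1 _
  have hevent : ∀ I : Finset ι, MeasurableSet {ω | ∀ i ∈ I, X i ω ∈ B → ω ∉ S i} := by
    intro I
    have : {ω | ∀ i ∈ I, X i ω ∈ B → ω ∉ S i} = ⋂ i ∈ I, (X i ⁻¹' B ∩ S i)ᶜ := by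
      ext ω
      simp
    rw [this]
    exact Finset.measurableSet_biInter _ fun i _ =>
      ((hX i hB).inter (hS.measurableSet i)).compl
  induction I using Finset.induction_on with
  | empty =>
    intro J A _ hA
    simpa using hS.cond_indep J A hA
  | insert i I hi ih =>
    intro J A hIJ hA
    have hiJ : i ∉ J := fun h => Finset.disjoint_left.1 hIJ (Finset.mem_insert_self i I) h
    have hIJ' : Disjoint I J := hIJ.mono_left (Finset.subset_insert i I)
    have hIJ'' : Disjoint I (insert i J) := Finset.disjoint_insert_right.2 ⟨hi, hIJ'⟩
    have hAB : MeasurableSet (A ∩ {x | x i ∈ B}) := hA.inter (measurable_pi_apply i hB)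
    have hY := ih J A hIJ' hA
    have hZ := ih (insert i J) _ hIJ'' hAB
    set P : Set Ω := {ω | (fun i => X i ω) ∈ A} with hP
    have hPm : MeasurableSet P := hXm hA
    set Y := (P ∩ ⋂ i ∈ J, S i) ∩ {ω | ∀ i ∈ I, X i ω ∈ B → ω ∉ S i} with hYdef
    set Z := ({ω | (fun i => X i ω) ∈ A ∩ {x | x i ∈ B}} ∩ ⋂ j ∈ insert i J, S j) ∩
      {ω | ∀ i ∈ I, X i ω ∈ B → ω ∉ S i} with hZdef
    have hZm : MeasurableSet Z := ((hXm hAB).inter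
      (Finset.measurableSet_biInter _ fun j _ => hS.measurableSet j)).inter (hevent I)
    have hsplit : (P ∩ ⋂ i ∈ J, S i) ∩ {ω | ∀ j ∈ insert i I, X j ω ∈ B → ω ∉ S j} = Y \ Z := by
      ext ω
      simp only [hYdef, hZdef, hP, mem_inter_iff, mem_ofPred_eq, mem_iInter, Set.mem_sdiff,
        Finset.forall_mem_insert]
      tauto
    have hZY : Z ⊆ Y := by
      intro ω
      simp only [hYdef, hZdef, hP, mem_inter_iff, mem_ofPred_eq, mem_iInter,
        Finset.forall_mem_insert]
      tauto
    rw [hsplit, measure_sdiff hZY hZm.nullMeasurableSet (measure_ne_top _ _), hY, hZ]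
    have hPB : {ω | (fun i => X i ω) ∈ A ∩ {x | x i ∈ B}} = (X i ⁻¹' B) ∩ P := by
      ext ω
      simp only [hP, mem_inter_iff, mem_ofPred_eq, mem_preimage]
      tauto
    have hkm : ∀ I : Finset ι, Measurable fun ω =>
        ∏ j ∈ I, (1 - B.indicator (fun x => ENNReal.ofReal (p ‖x‖)) (X j ω)) := fun I =>
      Finset.measurable_fun_prod _ fun j _ =>
        measurable_const.sub ((hq.indicator hB).comp (hX j))
    have hJm : Measurable fun ω => ∏ j ∈ J, ENNReal.ofReal (p ‖X j ω‖) :=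
      Finset.measurable_fun_prod _ fun j _ => hq.comp (hX j)
    have hZint : ∫⁻ ω in {ω | (fun i => X i ω) ∈ A ∩ {x | x i ∈ B}},
        (∏ j ∈ insert i J, ENNReal.ofReal (p ‖X j ω‖)) *
          ∏ j ∈ I, (1 - B.indicator (fun x => ENNReal.ofReal (p ‖x‖)) (X j ω)) ∂μ =
        ∫⁻ ω in P, B.indicator (fun x => ENNReal.ofReal (p ‖x‖)) (X i ω) *
          ((∏ j ∈ J, ENNReal.ofReal (p ‖X j ω‖)) *
            ∏ j ∈ I, (1 - B.indicator (fun x => ENNReal.ofReal (p ‖x‖)) (X j ω))) ∂μ := by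
      rw [hPB, ← Measure.restrict_restrict (hX i hB), ← lintegral_indicator (hX i hB)]
      refine lintegral_congr fun ω => ?_
      by_cases h : X i ω ∈ B
      · rw [indicator_of_mem (show ω ∈ X i ⁻¹' B from h), indicator_of_mem h,
          Finset.prod_insert hiJ, mul_assoc]
      · rw [indicator_of_notMem (show ω ∉ X i ⁻¹' B from h), indicator_of_notMem h, zero_mul]
    rw [← hZ, ← hY]
    -- Stated as a sum, from `(1 - b) + b = 1`, so that truncated subtraction never has to be
    -- distributed over a product.
    have hadd : μ Y = ∫⁻ ω in P, (∏ j ∈ J, ENNReal.ofReal (p ‖X j ω‖)) *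
        ∏ j ∈ insert i I, (1 - B.indicator (fun x => ENNReal.ofReal (p ‖x‖)) (X j ω)) ∂μ +
        μ Z := by
      have hm : Measurable fun ω => (∏ j ∈ J, ENNReal.ofReal (p ‖X j ω‖)) *
          ∏ j ∈ insert i I, (1 - B.indicator (fun x => ENNReal.ofReal (p ‖x‖)) (X j ω)) :=
        hJm.mul (hkm _)
      rw [hZ, hY, hZint, ← lintegral_add_left hm]
      refine lintegral_congr fun ω => ?_
      rw [Finset.prod_insert hi]
      set b := B.indicator (fun x => ENNReal.ofReal (p ‖x‖)) (X i ω)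
      set c := ∏ j ∈ J, ENNReal.ofReal (p ‖X j ω‖)
      set d := ∏ j ∈ I, (1 - B.indicator (fun x => ENNReal.ofReal (p ‖x‖)) (X j ω))
      have hb : (1 - b) + b = 1 := tsub_add_cancel_of_le (hq1 _)
      calc c * d = ((1 - b) + b) * (c * d) := by rw [hb, one_mul]
        _ = c * ((1 - b) * d) + b * (c * d) := by ring
    rw [hadd, ENNReal.add_sub_cancel_right (measure_ne_top _ _)]

/-- The case of the previous lemma where `B` is the whole plane and `J` is empty. -/
lemma IsLoSMarking.compl (hS : IsLoSMarking X S p μ) (hX : ∀ i, Measurable (X i))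
    (hp : Measurable p) (hp0 : ∀ x, 0 ≤ p x) (hp1 : ∀ x, p x ≤ 1) :
    IsLoSMarking X (fun i => (S i)ᶜ) (fun x => 1 - p x) μ where
  measurableSet i := (hS.measurableSet i).compl
  cond_indep I A hA := by
    have h := hS.measure_inter_forall hX hp hp1 MeasurableSet.univ I ∅ A (by simp) hA
    simp only [Finset.notMem_empty, iInter_of_empty, iInter_univ, inter_univ, mem_univ,
      forall_const, Finset.prod_empty, one_mul, indicator_univ] at h
    convert h using 4
    · ext ω
      simp
    · rw [ENNReal.ofReal_sub _ (hp0 _), ENNReal.ofReal_one]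

lemma IsLoSMarking.linkEvent {a b Δh : ℝ} (hS : IsLoSMarking X S (losProb a b Δh) μ)
    (hX : ∀ i, Measurable (X i)) (hp : Measurable (losProb a b Δh))
    (hp0 : ∀ x, 0 ≤ losProb a b Δh x) (hp1 : ∀ x, losProb a b Δh x ≤ 1) (c : Link) :
    IsLoSMarking X (linkEvent S c) (linkProb a b Δh c) μ := by
  cases c with
  | los => exact hS
  | nlos => exact hS.compl hX hp hp0 hp1

lemma measurable_nearestDist [Countable ι] (hX : ∀ i, Measurable (X i))
    (hS : ∀ i, MeasurableSet (S i)) : Measurable (nearestDist X S) := by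
  classical
  refine Measurable.iInf fun i => ?_
  have : (fun ω => ⨅ (_ : ω ∈ S i), ENNReal.ofReal ‖X i ω‖) =
      fun ω => if ω ∈ S i then ENNReal.ofReal ‖X i ω‖ else ∞ := by
    funext ω
    split_ifs with h <;> simp [h]
  rw [this]
  exact Measurable.ite (hS i) (hX i).norm.ennreal_ofReal measurable_const

/-- The probability that a point at distance `x` from the origin is not a marked point of the open
disc of radius `r`, if it is marked with probability `p x`. -/
def missProb (p : ℝ → ℝ) (r x : ℝ) : ℝ≥0∞ := 1 - (Iio r).indicator (fun x => ENNReal.ofReal (p x)) x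

lemma measurable_missProb (hp : Measurable p) (r : ℝ) : Measurable (missProb p r) :=
  measurable_const.sub (hp.ennreal_ofReal.indicator measurableSet_Iio)

lemma missProb_le_one (p : ℝ → ℝ) (r x : ℝ) : missProb p r x ≤ 1 := tsub_le_self

lemma missProb_of_le (p : ℝ → ℝ) {r x : ℝ} (h : r ≤ x) : missProb p r x = 1 := by
  simp [missProb, h]

lemma one_sub_missProb (hp1 : ∀ x, p x ≤ 1) (r x : ℝ) :
    1 - missProb p r x = (Iio r).indicator (fun x => ENNReal.ofReal (p x)) x := by
  refine ENNReal.sub_sub_cancel ENNReal.one_ne_top ((indicator_le_self _ _ x).trans ?_)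
  rw [ENNReal.ofReal_le_one]
  exact hp1 x

/-- The probability that there is no marked point in the open disc of radius `r`. -/
lemma IsLoSMarking.measure_le_nearestDist (hS : IsLoSMarking X S p μ)
    (hX : ∀ i, Measurable (X i)) (hp : Measurable p) (hp1 : ∀ x, p x ≤ 1)
    {s : ℕ → Finset ι} (hs : Monotone s) (hcover : ∀ i, ∃ n, i ∈ s n) (r : ℝ) :
    μ {ω | ENNReal.ofReal r ≤ nearestDist X S ω} =
      ∫⁻ ω, ⨅ n, ∏ i ∈ s n, missProb p r ‖X i ω‖ ∂μ := by
  have hB : MeasurableSet {x : Plane | ‖x‖ < r} := measurableSet_lt measurable_norm measurable_const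
  have hset : {ω | ENNReal.ofReal r ≤ nearestDist X S ω} =
      ⋂ n, {ω | ∀ i ∈ s n, X i ω ∈ {x : Plane | ‖x‖ < r} → ω ∉ S i} := by
    ext ω
    simp only [nearestDist, mem_ofPred_eq, le_iInf_iff, mem_iInter,
      ENNReal.ofReal_le_ofReal_iff (norm_nonneg _)]
    constructor
    · intro h n i _ hlt hi
      exact absurd (h i hi) (not_le.2 hlt)
    · intro h i hi
      obtain ⟨n, hn⟩ := hcover i
      exact not_lt.1 fun hlt => h n i hn hlt hi
  have hfin : ∀ n, μ {ω | ∀ i ∈ s n, X i ω ∈ {x : Plane | ‖x‖ < r} → ω ∉ S i} =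
      ∫⁻ ω, ∏ i ∈ s n, missProb p r ‖X i ω‖ ∂μ := by
    intro n
    have h := hS.measure_inter_forall hX hp hp1 hB (s n) ∅ univ (by simp) MeasurableSet.univ
    simp only [Finset.notMem_empty, iInter_of_empty, iInter_univ, inter_univ, mem_univ,
      ofPred_true, univ_inter, Finset.prod_empty, one_mul, Measure.restrict_univ] at h
    rw [h]
    rfl
  have hmeas : ∀ n, MeasurableSet {ω | ∀ i ∈ s n, X i ω ∈ {x : Plane | ‖x‖ < r} → ω ∉ S i} := by
    intro n
    have : {ω | ∀ i ∈ s n, X i ω ∈ {x : Plane | ‖x‖ < r} → ω ∉ S i} =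
        ⋂ i ∈ s n, (X i ⁻¹' {x : Plane | ‖x‖ < r} ∩ S i)ᶜ := by
      ext ω
      simp
    rw [this]
    exact Finset.measurableSet_biInter _ fun i _ =>
      ((hX i hB).inter (hS.measurableSet i)).compl
  have hanti : Antitone fun n => {ω | ∀ i ∈ s n, X i ω ∈ {x : Plane | ‖x‖ < r} → ω ∉ S i} :=
    fun m n hmn ω h i hi => h i (hs hmn hi)
  -- Continuity from above along the exhausting finite index sets, matched by monotone convergence
  -- of the products.
  rw [hset, hanti.measure_iInter (fun n => (hmeas n).nullMeasurableSet) ⟨0, measure_ne_top _ _⟩]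
  simp_rw [hfin]
  rw [lintegral_iInf]
  · exact fun n => Finset.measurable_fun_prod _ fun i _ =>
      (measurable_missProb hp r).comp (hX i).norm
  · exact fun m n hmn ω => Finset.prod_le_prod_of_subset_of_le_one' (hs hmn)
      fun i _ _ => missProb_le_one _ _ _
  · rw [← hfin]
    exact measure_ne_top _ _

end Marking

/-! ### Void probabilities of the Cox process -/

/-- The direction of the line drops out, so radial weights see only its distance and the abscissa.
-/
lemma norm_linePoint (ρ φ t : ℝ) : ‖linePoint ρ φ t‖ = Real.sqrt (ρ ^ 2 + t ^ 2) := by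
  rw [EuclideanSpace.norm_eq]
  congr 1
  simp only [linePoint, Fin.sum_univ_two, Real.norm_eq_abs, sq_abs]
  simp only [Matrix.cons_val_zero, Matrix.cons_val_one]
  linear_combination (ρ ^ 2 + t ^ 2) * Real.sin_sq_add_cos_sq φ

lemma measurable_linePoint : Measurable fun x : ℝ × ℝ × ℝ => linePoint x.1 x.2.1 x.2.2 := by
  unfold linePoint
  fun_prop

/-- The probability that a line at distance `ρ` carries no point that is not missed, if the point at
distance `x` from the origin is missed with probability `w x`. -/
def lineMiss (lp : ℝ) (w : ℝ → ℝ≥0∞) (ρ : ℝ) : ℝ≥0∞ :=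
  expNeg (∫⁻ t, (1 - w (Real.sqrt (ρ ^ 2 + t ^ 2))) ∂(ENNReal.ofReal lp • (volume : Measure ℝ)))

lemma measurable_lineMiss (lp : ℝ) {w : ℝ → ℝ≥0∞} (hw : Measurable w) :
    Measurable (lineMiss lp w) := by
  refine measurable_expNeg.comp (Measurable.lintegral_prod_right' (f := fun x : ℝ × ℝ =>
    1 - w (Real.sqrt (x.1 ^ 2 + x.2 ^ 2))) ?_)
  exact measurable_const.sub (hw.comp (by fun_prop))

/-- Such a line misses the open disc. Hence only lines from a set of finite intensity carry a weight
other than `1`. -/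
lemma lineMiss_of_le (lp : ℝ) {w : ℝ → ℝ≥0∞} {r ρ : ℝ} (hw : ∀ x, r ≤ x → w x = 1)
    (h : r ≤ |ρ|) : lineMiss lp w ρ = 1 := by
  have : ∀ t, w (Real.sqrt (ρ ^ 2 + t ^ 2)) = 1 := fun t =>
    hw _ (h.trans (Real.abs_le_sqrt (by nlinarith [sq_nonneg t])))
  simp [lineMiss, this, expNeg_zero]

lemma iInf_diagonal {f : ℕ → ℕ → ℝ≥0∞} (h1 : ∀ n, Antitone fun m => f m n)
    (h2 : ∀ m, Antitone (f m)) : ⨅ n, f n n = ⨅ m, ⨅ n, f m n := by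
  refine le_antisymm (le_iInf₂ fun m n => ?_) (le_iInf fun n =>
    iInf₂_le (f := fun m n => f m n) n n)
  exact (iInf_le _ (max m n)).trans
    ((h1 _ (le_max_left m n)).trans (h2 _ (le_max_right m n)))

/-- The first `n` lines, together with the typical one. -/
def firstLines (n : ℕ) : Finset (Option ℕ) := Finset.insertNone (Finset.range n)

lemma monotone_firstLines : Monotone firstLines := fun m n hmn o ho => by
  cases o with
  | none => simp [firstLines]
  | some j =>
    simp only [firstLines, Finset.some_mem_insertNone, Finset.mem_range] at ho ⊢
    omega

lemma prod_firstLines (c : Option ℕ → ℝ≥0∞) (n : ℕ) :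
    ∏ o ∈ firstLines n, c o = c none * ∏ j ∈ Finset.range n, c (some j) := by
  rw [firstLines, Finset.prod_insertNone]

/-- The distance from the origin of a line, the typical one being at distance `y`. -/
def lineDist (y : ℝ) (l : ℕ → ℝ × ℝ) : Option ℕ → ℝ
  | none => y
  | some j => (l j).1

lemma measurable_lineDist (y : ℝ) (o : Option ℕ) : Measurable fun l => lineDist y l o := by
  cases o with
  | none => exact measurable_const
  | some j => exact (measurable_pi_apply j).fst

lemma norm_coxPoint (y φ₀ : ℝ) (o : Option ℕ) (k : ℕ) {Ω : Type*} {L : ℕ → Ω → ℝ × ℝ}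
    {T : Option ℕ → ℕ → Ω → ℝ} (ω : Ω) :
    ‖coxPoint L T y φ₀ (o, k) ω‖ =
      Real.sqrt (lineDist y (fun j => L j ω) o ^ 2 + T o k ω ^ 2) := by
  cases o <;> exact norm_linePoint _ _ _

/-- The weight of all the points on the line `o`. -/
def lineWeight (w : ℝ → ℝ≥0∞) (y : ℝ) (l : ℕ → ℝ × ℝ) (t : Option ℕ → ℕ → ℝ) (o : Option ℕ) :
    ℝ≥0∞ :=
  infProd fun k => w (Real.sqrt (lineDist y l o ^ 2 + t o k ^ 2))

lemma lineWeight_le_one (w : ℝ → ℝ≥0∞) (y : ℝ) (l : ℕ → ℝ × ℝ) (t : Option ℕ → ℕ → ℝ)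
    (o : Option ℕ) : lineWeight w y l t o ≤ 1 :=
  infProd_le_one _

lemma measurable_prod_lineWeight {α : Type*} [MeasurableSpace α] {w : ℝ → ℝ≥0∞} (hw : Measurable w)
    (y : ℝ) {l : α → ℕ → ℝ × ℝ} {t : α → Option ℕ → ℕ → ℝ} (hl : Measurable l) (ht : Measurable t)
    (s : Finset (Option ℕ)) : Measurable fun x => ∏ o ∈ s, lineWeight w y (l x) (t x) o := by
  refine Finset.measurable_fun_prod _ fun o _ => measurable_infProd fun k => hw.comp ?_
  have h1 : Measurable fun x => lineDist y (l x) o := (measurable_lineDist y o).comp hl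
  have h2 : Measurable fun x => t x o k := by fun_prop
  exact ((h1.pow_const 2).add (h2.pow_const 2)).sqrt

lemma antitone_prod_firstLines {c : Option ℕ → ℝ≥0∞} (hc : ∀ o, c o ≤ 1) :
    Antitone fun m => ∏ o ∈ firstLines m, c o := fun _ _ hmm =>
  Finset.prod_le_prod_of_subset_of_le_one' (monotone_firstLines hmm) fun o _ _ => hc o

/-- By monotonicity the limit over growing squares of indices is an iterated one: first all points
on finitely many lines, then all lines. -/
lemma iInf_prod_coxPoint {w : ℝ → ℝ≥0∞} (hw1 : ∀ x, w x ≤ 1) (y φ₀ : ℝ) {Ω : Type*}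
    {L : ℕ → Ω → ℝ × ℝ} {T : Option ℕ → ℕ → Ω → ℝ} (ω : Ω) :
    ⨅ n, ∏ i ∈ firstLines n ×ˢ Finset.range n, w ‖coxPoint L T y φ₀ i ω‖ =
      ⨅ m, ∏ o ∈ firstLines m, lineWeight w y (fun j => L j ω) (fun o k => T o k ω) o := by
  simp_rw [Finset.prod_product, norm_coxPoint]
  rw [iInf_diagonal (f := fun m n => ∏ o ∈ firstLines m, ∏ k ∈ Finset.range n,
    w (Real.sqrt (lineDist y (fun j => L j ω) o ^ 2 + T o k ω ^ 2)))]
  · exact iInf_congr fun m => prod_iInf_of_antitone _ (fun o _ => antitone_prod_range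
      fun k => hw1 _) fun o _ n => Finset.prod_le_one' fun k _ => hw1 _
  · exact fun n => antitone_prod_firstLines fun o => Finset.prod_le_one' fun k _ => hw1 _
  · exact fun m n n' hnn => Finset.prod_le_prod' fun o _ => antitone_prod_range
      (fun k => hw1 _) hnn

/-! ### Generating functional of the Cox process with the typical line -/

section Cox

variable {Ω : Type*} [MeasurableSpace Ω] {μ : Measure Ω}
  {L : ℕ → Ω → ℝ × ℝ} {T : Option ℕ → ℕ → Ω → ℝ} {ll lp : ℝ}

lemma measurable_coxPoint (hLT : IsPLCP L T ll lp μ) (y φ₀ : ℝ) (i : Option ℕ × ℕ) :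
    Measurable (coxPoint L T y φ₀ i) := by
  obtain ⟨o, k⟩ := i
  have hT := (hLT.points o).measurable k
  cases o with
  | none =>
    exact measurable_linePoint.comp (measurable_const.prodMk (measurable_const.prodMk hT))
  | some j =>
    have hL := hLT.lines.measurable j
    exact measurable_linePoint.comp (hL.fst.prodMk (hL.snd.prodMk hT))

lemma IsPLCP.measurable_lines (hLT : IsPLCP L T ll lp μ) : Measurable fun ω j => L j ω :=
  measurable_pi_lambda _ hLT.lines.measurable

lemma IsPLCP.measurable_abscissas (hLT : IsPLCP L T ll lp μ) : Measurable fun ω o k => T o k ω :=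
  measurable_pi_lambda _ fun o => measurable_pi_lambda _ fun k => (hLT.points o).measurable k

variable [IsProbabilityMeasure μ]

lemma lintegral_infProd_line (hLT : IsPLCP L T ll lp μ) {w : ℝ → ℝ≥0∞} (hw : Measurable w)
    (hw1 : ∀ x, w x ≤ 1) {r : ℝ} (hr : ∀ x, r ≤ x → w x = 1) (o : Option ℕ) (ρ : ℝ) :
    ∫⁻ ω, infProd (fun k => w (Real.sqrt (ρ ^ 2 + T o k ω ^ 2))) ∂μ = lineMiss lp w ρ := by
  refine (hLT.points o).lintegral_infProd (g := fun t => w (Real.sqrt (ρ ^ 2 + t ^ 2)))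
    (hw.comp (by fun_prop)) (fun t => hw1 _) ?_
  have hsub : {t | w (Real.sqrt (ρ ^ 2 + t ^ 2)) ≠ 1} ⊆ Icc (-r) r := by
    intro t ht
    refine abs_le.1 ?_
    by_contra hlt
    exact ht (hr _ ((not_le.1 hlt).le.trans (Real.abs_le_sqrt (by nlinarith [sq_nonneg ρ]))))
  refine ne_top_of_le_ne_top ?_ (measure_mono hsub)
  rw [Measure.smul_apply, smul_eq_mul, Real.volume_Icc]
  exact ENNReal.mul_ne_top ENNReal.ofReal_ne_top ENNReal.ofReal_ne_top

lemma lineIntensity_ne_top (ll r : ℝ) : lineIntensity ll {l | |l.1| < r} ≠ ∞ := by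
  have hms : MeasurableSet (Ici (0 : ℝ) ×ˢ Ico 0 (2 * Real.pi)) :=
    measurableSet_Ici.prod measurableSet_Ico
  rw [lineIntensity, Measure.smul_apply, smul_eq_mul, Measure.restrict_apply' hms]
  refine ENNReal.mul_ne_top ENNReal.ofReal_ne_top ?_
  have hsub : {l : ℝ × ℝ | |l.1| < r} ∩ Ici (0 : ℝ) ×ˢ Ico 0 (2 * Real.pi) ⊆
      Icc (-r) r ×ˢ Ico 0 (2 * Real.pi) := by
    rintro l ⟨h1, h2⟩
    exact ⟨abs_le.1 (le_of_lt h1), h2.2⟩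
  refine ne_top_of_le_ne_top ?_ (measure_mono hsub)
  rw [Measure.volume_eq_prod, Measure.prod_prod, Real.volume_Icc, Real.volume_Ico]
  exact ENNReal.mul_ne_top ENNReal.ofReal_ne_top ENNReal.ofReal_ne_top

/-- Averaging over the points on given lines. -/
lemma IsPLCP.lintegral_prod_lineWeight_of_lines (hLT : IsPLCP L T ll lp μ) (y : ℝ)
    {w : ℝ → ℝ≥0∞} (hw : Measurable w) (hw1 : ∀ x, w x ≤ 1) {r : ℝ} (hr : ∀ x, r ≤ x → w x = 1)
    (l : ℕ → ℝ × ℝ) (m : ℕ) :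
    ∫⁻ ω, ∏ o ∈ firstLines m, lineWeight w y l (fun o k => T o k ω) o ∂μ =
      lineMiss lp w y * ∏ j ∈ Finset.range m, lineMiss lp w (l j).1 := by
  have hm : ∀ o : Option ℕ, Measurable fun t : ℕ → ℝ =>
      infProd fun k => w (Real.sqrt (lineDist y l o ^ 2 + t k ^ 2)) := fun o =>
    measurable_infProd fun k => hw.comp (by fun_prop)
  -- With the lines frozen, each weight depends on the points of one line only, so the mean of the
  -- product factorises.
  have hind := hLT.indep_points.comp (γ := fun _ => ℝ≥0∞) _ hm
  have hTo : ∀ o, Measurable fun ω k => T o k ω := fun o =>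
    measurable_pi_lambda _ fun k => (hLT.points o).measurable k
  have h := lintegral_prod_eq_prod_lintegral_of_indepFun (firstLines m) _ hind
    fun o => (hm o).comp (hTo o)
  rw [prod_firstLines] at h
  refine h.trans (congrArg₂ _ ?_ (Finset.prod_congr rfl fun j _ => ?_))
  · exact lintegral_infProd_line hLT hw hw1 hr none y
  · exact lintegral_infProd_line hLT hw hw1 hr (some j) (l j).1

/-- Lines and abscissas are independent, so their joint law is a product, and Fubini reduces to
given lines. -/
lemma IsPLCP.lintegral_prod_lineWeight (hLT : IsPLCP L T ll lp μ) (y : ℝ)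
    {w : ℝ → ℝ≥0∞} (hw : Measurable w) (hw1 : ∀ x, w x ≤ 1) {r : ℝ} (hr : ∀ x, r ≤ x → w x = 1)
    (m : ℕ) :
    ∫⁻ ω, ∏ o ∈ firstLines m, lineWeight w y (fun j => L j ω) (fun o k => T o k ω) o ∂μ =
      lineMiss lp w y * ∫⁻ ω, ∏ j ∈ Finset.range m, lineMiss lp w (L j ω).1 ∂μ := by
  have hF : Measurable fun x : (ℕ → ℝ × ℝ) × (Option ℕ → ℕ → ℝ) =>
      ∏ o ∈ firstLines m, lineWeight w y x.1 x.2 o :=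
    measurable_prod_lineWeight hw y measurable_fst measurable_snd _
  have hLm := hLT.measurable_lines
  have hTm := hLT.measurable_abscissas
  have h1 := lintegral_map (μ := μ) hF (hLm.prodMk hTm)
  have := Measure.isProbabilityMeasure_map (μ := μ) hTm.aemeasurable
  rw [(indepFun_iff_map_prod_eq_prod_map_map hLm.aemeasurable hTm.aemeasurable).1
    hLT.indep_lines, lintegral_prod _ hF.aemeasurable] at h1
  have hV : Measurable fun ω => ∏ j ∈ Finset.range m, lineMiss lp w (L j ω).1 :=
    Finset.measurable_fun_prod _ fun j _ =>
      (measurable_lineMiss lp hw).comp (hLT.lines.measurable j).fst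
  rw [← h1, lintegral_map hF.lintegral_prod_right' hLm, ← lintegral_const_mul _ hV]
  refine lintegral_congr fun ω => ?_
  have hG : Measurable fun t : Option ℕ → ℕ → ℝ =>
      ∏ o ∈ firstLines m, lineWeight w y (fun j => L j ω) t o :=
    measurable_prod_lineWeight hw y measurable_const measurable_id _
  refine (lintegral_map hG hTm).trans ?_
  exact hLT.lintegral_prod_lineWeight_of_lines y hw hw1 hr _ m

lemma IsPLCP.lintegral_infProd_lineMiss (hLT : IsPLCP L T ll lp μ)
    {w : ℝ → ℝ≥0∞} (hw : Measurable w) {r : ℝ} (hr : ∀ x, r ≤ x → w x = 1) :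
    ∫⁻ ω, infProd (fun j => lineMiss lp w (L j ω).1) ∂μ =
      expNeg (∫⁻ l, (1 - lineMiss lp w l.1) ∂lineIntensity ll) := by
  refine hLT.lines.lintegral_infProd ((measurable_lineMiss lp hw).comp measurable_fst)
    (fun _ => expNeg_le_one _) ?_
  refine ne_top_of_le_ne_top (lineIntensity_ne_top ll r) (measure_mono fun l hl => ?_)
  exact not_le.1 fun h => hl (lineMiss_of_le lp hr h)

/-- The probability generating functional of the Cox process together with the typical line, for a
weight that depends on the distance from the origin only. -/
theorem IsPLCP.lintegral_iInf_prod (hLT : IsPLCP L T ll lp μ) (y φ₀ : ℝ) {w : ℝ → ℝ≥0∞}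
    (hw : Measurable w) (hw1 : ∀ x, w x ≤ 1) {r : ℝ} (hr : ∀ x, r ≤ x → w x = 1) :
    ∫⁻ ω, ⨅ n, ∏ i ∈ firstLines n ×ˢ Finset.range n, w ‖coxPoint L T y φ₀ i ω‖ ∂μ =
      lineMiss lp w y * expNeg (∫⁻ l, (1 - lineMiss lp w l.1) ∂lineIntensity ll) := by
  set F : ℕ → Ω → ℝ≥0∞ := fun m ω =>
    ∏ o ∈ firstLines m, lineWeight w y (fun j => L j ω) (fun o k => T o k ω) o with hF
  have hFm : ∀ m, Measurable (F m) := fun m =>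
    measurable_prod_lineWeight hw y hLT.measurable_lines hLT.measurable_abscissas _
  have hFanti : Antitone F := fun m n hmn ω =>
    antitone_prod_firstLines (lineWeight_le_one w y _ _) hmn
  have hFint : ∀ m, ∫⁻ ω, F m ω ∂μ =
      lineMiss lp w y * ∫⁻ ω, ∏ j ∈ Finset.range m, lineMiss lp w (L j ω).1 ∂μ := fun m =>
    hLT.lintegral_prod_lineWeight y hw hw1 hr m
  have hF0 : ∫⁻ ω, F 0 ω ∂μ ≠ ∞ := by
    rw [hFint]
    simpa using (show lineMiss lp w y ≠ ∞ from expNeg_ne_top _)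
  have hne : lineMiss lp w y ≠ ∞ := expNeg_ne_top _
  have hV : ∀ m, Measurable fun ω => ∏ j ∈ Finset.range m, lineMiss lp w (L j ω).1 := fun m =>
    Finset.measurable_fun_prod _ fun j _ =>
      (measurable_lineMiss lp hw).comp (hLT.lines.measurable j).fst
  have hVanti : Antitone fun m ω => ∏ j ∈ Finset.range m, lineMiss lp w (L j ω).1 :=
    fun m n hmn ω => antitone_prod_range (fun j => expNeg_le_one _) hmn
  have hpt : ∀ ω, ⨅ n, ∏ i ∈ firstLines n ×ˢ Finset.range n, w ‖coxPoint L T y φ₀ i ω‖ =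
      ⨅ m, F m ω := fun ω => iInf_prod_coxPoint hw1 y φ₀ ω
  rw [lintegral_congr hpt, lintegral_iInf hFm hFanti hF0]
  simp_rw [hFint]
  rw [← ENNReal.mul_iInf fun h => absurd h hne, ← lintegral_iInf hV hVanti (by simp)]
  exact congrArg _ (hLT.lintegral_infProd_lineMiss hw hr)

end Cox

/-! ### Hazard rates -/

lemma lintegral_of_even {f : ℝ → ℝ≥0∞} (heven : ∀ t, f (-t) = f t) :
    ∫⁻ t, f t = 2 * ∫⁻ t in Ioi 0, f t := by
  have h1 := (Measure.measurePreserving_neg (volume : Measure ℝ)).setLIntegral_comp_preimage_emb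
    (Homeomorph.neg ℝ).measurableEmbedding f (Iio 0)
  have h2 : (Neg.neg : ℝ → ℝ) ⁻¹' Iio 0 = Ioi 0 := by
    ext x
    simp
  rw [h2] at h1
  simp only [heven] at h1
  rw [← lintegral_add_compl f measurableSet_Ioi (A := Ioi (0 : ℝ)), compl_Ioi,
    setLIntegral_congr Iio_ae_eq_Iic.symm, ← h1, two_mul]

section Line

variable {p : ℝ → ℝ} {lp : ℝ}

/-- The disc cuts the line in a chord of half-length `√(r² - ρ²)`, and the two halves give the
factor `2`. If the line misses the disc, the square root is `0` by convention and the interval is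
empty. -/
lemma lintegral_one_sub_missProb_line (hp1 : ∀ x, p x ≤ 1) (ρ : ℝ) {r : ℝ}
    (hr : 0 ≤ r) :
    ∫⁻ t, (1 - missProb p r (Real.sqrt (ρ ^ 2 + t ^ 2))) ∂(ENNReal.ofReal lp • volume) =
      ENNReal.ofReal (2 * lp) * ∫⁻ t in Ioo 0 (Real.sqrt (r ^ 2 - ρ ^ 2)),
        ENNReal.ofReal (p (Real.sqrt (ρ ^ 2 + t ^ 2))) := by
  rw [lintegral_smul_measure, lintegral_of_even (by simp), smul_eq_mul, ← mul_assoc, mul_comm _ 2,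
    ENNReal.ofReal_mul zero_le_two, ENNReal.ofReal_ofNat]
  congr 1
  simp_rw [one_sub_missProb hp1]
  rw [← lintegral_indicator measurableSet_Ioi, ← lintegral_indicator measurableSet_Ioo]
  refine lintegral_congr fun t => ?_
  by_cases ht : 0 < t
  · rw [indicator_of_mem (show t ∈ Ioi 0 from ht)]
    have hiff : Real.sqrt (ρ ^ 2 + t ^ 2) < r ↔ t < Real.sqrt (r ^ 2 - ρ ^ 2) := by
      rw [Real.lt_sqrt ht.le, Real.sqrt_lt (by positivity) hr]
      constructor <;> intro h <;> linarith
    by_cases h : Real.sqrt (ρ ^ 2 + t ^ 2) < r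
    · rw [indicator_of_mem (show _ ∈ Iio r from h),
        indicator_of_mem (show t ∈ Ioo 0 _ from ⟨ht, hiff.1 h⟩)]
    · rw [indicator_of_notMem (show _ ∉ Iio r from h),
        indicator_of_notMem fun h' => h (hiff.2 h'.2)]
  · rw [indicator_of_notMem (show t ∉ Ioi 0 from ht), indicator_of_notMem fun h' => ht h'.1]

lemma lintegral_one_sub_missProb_line_ne_top (hp1 : ∀ x, p x ≤ 1) (ρ : ℝ) {r : ℝ}
    (hr : 0 ≤ r) :
    ∫⁻ t, (1 - missProb p r (Real.sqrt (ρ ^ 2 + t ^ 2))) ∂(ENNReal.ofReal lp • volume) ≠ ∞ := by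
  rw [lintegral_one_sub_missProb_line hp1 ρ hr]
  refine ENNReal.mul_ne_top ENNReal.ofReal_ne_top ?_
  refine ne_top_of_le_ne_top (b := ∫⁻ t in Ioo 0 (Real.sqrt (r ^ 2 - ρ ^ 2)), 1) ?_
    (lintegral_mono fun t => ENNReal.ofReal_le_one.2 (hp1 _))
  simp

lemma toReal_lintegral_one_sub_missProb_line (hp : Measurable p) (hp0 : ∀ x, 0 ≤ p x)
    (hp1 : ∀ x, p x ≤ 1) (hlp : 0 ≤ lp) (ρ : ℝ) {r : ℝ} (hr : 0 ≤ r) :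
    (∫⁻ t, (1 - missProb p r (Real.sqrt (ρ ^ 2 + t ^ 2))) ∂(ENNReal.ofReal lp • volume)).toReal =
      2 * lp * ∫ z in (0 : ℝ)..Real.sqrt (r ^ 2 - ρ ^ 2), p (Real.sqrt (ρ ^ 2 + z ^ 2)) := by
  rw [lintegral_one_sub_missProb_line hp1 ρ hr, ENNReal.toReal_mul,
    ENNReal.toReal_ofReal (by positivity), intervalIntegral.integral_of_le (Real.sqrt_nonneg _),
    integral_Ioc_eq_integral_Ioo, integral_eq_lintegral_of_nonneg_ae]
  · exact Eventually.of_forall fun t => hp0 _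
  · exact (hp.comp (by fun_prop)).aestronglyMeasurable

/-- The rate at which the points at distance `s` from the origin are met on a line at distance
`ρ`. -/
def lineHazard (lp : ℝ) (p : ℝ → ℝ) (ρ s : ℝ) : ℝ≥0∞ :=
  ENNReal.ofReal (2 * lp * (s / Real.sqrt (s ^ 2 - ρ ^ 2)) * p s)

lemma measurable_lineHazard (hp : Measurable p) :
    Measurable fun x : ℝ × ℝ => lineHazard lp p x.1 x.2 := by
  unfold lineHazard
  fun_prop

/-- The conventions `√x = 0` for `x ≤ 0` and `s / 0 = 0` make the hazard vanish until the disc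
crosses the line. -/
lemma lineHazard_of_le {ρ s : ℝ} (hs : 0 ≤ s) (h : s ≤ ρ) : lineHazard lp p ρ s = 0 := by
  rw [lineHazard, Real.sqrt_eq_zero_of_nonpos (by nlinarith)]
  simp

lemma image_sqrt_sub_Ioo {ρ r : ℝ} (hρ : 0 ≤ ρ) (hr : 0 ≤ r) :
    (fun s => Real.sqrt (s ^ 2 - ρ ^ 2)) '' Ioo ρ r = Ioo 0 (Real.sqrt (r ^ 2 - ρ ^ 2)) := by
  refine Subset.antisymm ?_ ?_
  · rintro _ ⟨s, hs, rfl⟩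
    refine ⟨Real.sqrt_pos.2 (by nlinarith [hs.1]), Real.sqrt_lt_sqrt ?_ ?_⟩ <;>
      nlinarith [hs.1, hs.2]
  · rintro t ⟨ht, htr⟩
    rw [Real.lt_sqrt ht.le] at htr
    refine ⟨Real.sqrt (ρ ^ 2 + t ^ 2), ⟨Real.lt_sqrt_of_sq_lt (by nlinarith), ?_⟩, ?_⟩
    · rw [Real.sqrt_lt (by positivity) hr]
      linarith
    · simp only
      rw [Real.sq_sqrt (by positivity), add_sub_cancel_left, Real.sqrt_sq ht.le]

/-- The mean number of marked points within distance `r` on a line at distance `ρ`, as the integral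
of the hazard rate. -/
lemma lintegral_one_sub_missProb_line_eq_lineHazard (hp1 : ∀ x, p x ≤ 1) (hlp : 0 ≤ lp) {ρ r : ℝ}
    (hρ : 0 ≤ ρ) (hr : 0 ≤ r) :
    ∫⁻ t, (1 - missProb p r (Real.sqrt (ρ ^ 2 + t ^ 2))) ∂(ENNReal.ofReal lp • volume) =
      ∫⁻ s in Ioo ρ r, lineHazard lp p ρ s := by
  have himg := image_sqrt_sub_Ioo hρ hr
  have hpos : ∀ s ∈ Ioo ρ r, 0 < s ^ 2 - ρ ^ 2 := fun s hs => by nlinarith [hs.1]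
  have hderiv : ∀ s ∈ Ioo ρ r, HasDerivWithinAt (fun s => Real.sqrt (s ^ 2 - ρ ^ 2))
      (s / Real.sqrt (s ^ 2 - ρ ^ 2)) (Ioo ρ r) s := by
    intro s hs
    have h1 : HasDerivAt (fun s : ℝ => s ^ 2 - ρ ^ 2) (2 * s) s := by
      simpa using (hasDerivAt_pow 2 s).sub_const (ρ ^ 2)
    have h2 := h1.sqrt (hpos s hs).ne'
    rw [mul_div_mul_left _ _ two_ne_zero] at h2
    exact h2.hasDerivWithinAt
  have hinj : InjOn (fun s => Real.sqrt (s ^ 2 - ρ ^ 2)) (Ioo ρ r) := by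
    intro s hs s' hs' h
    have h1 := (Real.sqrt_inj (hpos s hs).le (hpos s' hs').le).1 h
    have h2 : s ^ 2 = s' ^ 2 := by linarith
    exact (pow_left_inj₀ (hρ.trans hs.1.le) (hρ.trans hs'.1.le) two_ne_zero).1 h2
  -- Substitution `t = √(s² - ρ²)`: then `√(ρ² + t²) = s` and `dt = s / √(s² - ρ²) ds`.
  rw [lintegral_one_sub_missProb_line hp1 ρ hr, ← himg,
    lintegral_image_eq_lintegral_abs_deriv_mul measurableSet_Ioo hderiv hinj,
    ← lintegral_const_mul' _ _ ENNReal.ofReal_ne_top]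
  refine setLIntegral_congr_fun measurableSet_Ioo fun s hs => ?_
  have hs0 : 0 ≤ s := hρ.trans hs.1.le
  have h1 : 0 ≤ s / Real.sqrt (s ^ 2 - ρ ^ 2) := div_nonneg hs0 (Real.sqrt_nonneg _)
  rw [abs_of_nonneg h1, Real.sq_sqrt (hpos s hs).le, add_sub_cancel, Real.sqrt_sq hs0, lineHazard,
    ← ENNReal.ofReal_mul h1, ← ENNReal.ofReal_mul (by positivity), mul_assoc (2 * lp)]

lemma lineMiss_missProb (hp1 : ∀ x, p x ≤ 1) (hlp : 0 ≤ lp) {ρ r : ℝ} (hρ : 0 ≤ ρ) (hr : 0 ≤ r) :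
    lineMiss lp (missProb p r) ρ = expNeg (∫⁻ s in Ioo ρ r, lineHazard lp p ρ s) := by
  rw [lineMiss, lintegral_one_sub_missProb_line_eq_lineHazard hp1 hlp hρ hr]

lemma lineMiss_missProb_eq_lineVoid (hp : Measurable p) (hp0 : ∀ x, 0 ≤ p x) (hp1 : ∀ x, p x ≤ 1)
    (hlp : 0 ≤ lp) (ρ : ℝ) {r : ℝ} (hr : 0 ≤ r) :
    lineMiss lp (missProb p r) ρ = ENNReal.ofReal (lineVoid lp p r ρ) := by
  rw [lineMiss, expNeg, toReal_lintegral_one_sub_missProb_line hp hp0 hp1 hlp ρ hr, lineVoid]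

/-- The hazard identity at fixed `ρ`; it replaces differentiation in `r` of the void probability of
the line. -/
lemma one_sub_lineMiss_missProb (hp : Measurable p) (hp1 : ∀ x, p x ≤ 1) (hlp : 0 ≤ lp) {ρ r : ℝ}
    (hρ : 0 ≤ ρ) (hr : 0 ≤ r) :
    1 - lineMiss lp (missProb p r) ρ =
      ∫⁻ s in Ioo ρ r, lineHazard lp p ρ s * lineMiss lp (missProb p s) ρ := by
  have hfin : ∫⁻ s in Ioo ρ r, lineHazard lp p ρ s ≠ ∞ := by
    rw [← lintegral_one_sub_missProb_line_eq_lineHazard hp1 hlp hρ hr]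
    exact lintegral_one_sub_missProb_line_ne_top hp1 ρ hr
  have hm : Measurable fun s => lineHazard lp p ρ s :=
    (measurable_lineHazard hp).comp measurable_prodMk_left
  rw [lineMiss_missProb hp1 hlp hρ hr, ← lintegral_hazard_mul_expNeg hm hfin]
  refine setLIntegral_congr_fun measurableSet_Ioo fun s hs => ?_
  rw [lineMiss_missProb hp1 hlp hρ (hρ.trans hs.1.le)]

lemma measurable_lineMiss_missProb (hp : Measurable p) (lp : ℝ) :
    Measurable fun x : ℝ × ℝ => lineMiss lp (missProb p x.2) x.1 := by
  refine measurable_expNeg.comp (Measurable.lintegral_prod_right' (f := fun x : (ℝ × ℝ) × ℝ =>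
    1 - missProb p x.1.2 (Real.sqrt (x.1.1 ^ 2 + x.2 ^ 2))) ?_)
  refine measurable_const.sub (measurable_const.sub ?_)
  have hd : Measurable fun x : (ℝ × ℝ) × ℝ => Real.sqrt (x.1.1 ^ 2 + x.2 ^ 2) := by fun_prop
  have hset : MeasurableSet {x : (ℝ × ℝ) × ℝ | Real.sqrt (x.1.1 ^ 2 + x.2 ^ 2) < x.1.2} :=
    measurableSet_lt hd (by fun_prop)
  have := (hp.comp hd).ennreal_ofReal.indicator hset
  exact this

/-! ### The lines of the Poisson line process -/

lemma lintegral_lineIntensity {ll : ℝ} (hll : 0 ≤ ll) {f : ℝ → ℝ≥0∞} (hf : Measurable f) :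
    ∫⁻ l, f l.1 ∂lineIntensity ll = ENNReal.ofReal (2 * Real.pi * ll) * ∫⁻ ρ in Ici 0, f ρ := by
  rw [lineIntensity, lintegral_smul_measure, Measure.volume_eq_prod, ← Measure.prod_restrict,
    lintegral_prod _ (show Measurable fun l : ℝ × ℝ => f l.1 from
      hf.comp measurable_fst).aemeasurable]
  simp only [lintegral_const, Measure.restrict_apply MeasurableSet.univ, univ_inter,
    Real.volume_Ico, sub_zero]
  rw [lintegral_mul_const _ hf, smul_eq_mul, mul_comm (∫⁻ _ in _, _), ← mul_assoc,
    ← ENNReal.ofReal_mul hll]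
  ring_nf

/-- The rate at which the points at distance `s` from the origin are met on the lines of the
Poisson line process. -/
def coxHazard (ll lp : ℝ) (p : ℝ → ℝ) (s : ℝ) : ℝ≥0∞ :=
  ENNReal.ofReal (2 * Real.pi * ll) *
    ∫⁻ ρ in Ioo 0 s, lineHazard lp p ρ s * lineMiss lp (missProb p s) ρ

lemma measurable_lineHazard_mul (hp : Measurable p) :
    Measurable fun x : ℝ × ℝ => lineHazard lp p x.1 x.2 * lineMiss lp (missProb p x.2) x.1 :=
  (measurable_lineHazard hp).mul (measurable_lineMiss_missProb hp lp)

lemma measurable_coxHazard (hp : Measurable p) (ll : ℝ) : Measurable (coxHazard ll lp p) := by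
  have hset : MeasurableSet {x : ℝ × ℝ | 0 < x.2 ∧ x.2 < x.1} :=
    (measurableSet_lt measurable_const measurable_snd).inter
      (measurableSet_lt measurable_snd measurable_fst)
  have hm := ((measurable_lineHazard_mul (lp := lp) hp).comp measurable_swap).indicator hset
  refine Measurable.const_mul ?_ _
  convert hm.lintegral_prod_right' (ν := volume) using 2 with s
  rw [← lintegral_indicator measurableSet_Ioo]
  rfl

lemma lintegral_one_sub_lineMiss (hp : Measurable p) (lp : ℝ) {ll : ℝ} (hll : 0 ≤ ll) (r : ℝ) :
    ∫⁻ l, (1 - lineMiss lp (missProb p r) l.1) ∂lineIntensity ll =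
      ENNReal.ofReal (2 * Real.pi * ll) *
        ∫⁻ ρ in Ioo 0 r, (1 - lineMiss lp (missProb p r) ρ) := by
  have hm : Measurable fun ρ => 1 - lineMiss lp (missProb p r) ρ :=
    measurable_const.sub (measurable_lineMiss lp (measurable_missProb hp r))
  rw [lintegral_lineIntensity hll hm, setLIntegral_congr Ioi_ae_eq_Ici.symm, ← lintegral_indicator measurableSet_Ioi,
    ← lintegral_indicator measurableSet_Ioo]
  congr 1
  refine lintegral_congr fun ρ => ?_
  by_cases h0 : 0 < ρ
  · by_cases h : ρ < r
    · rw [indicator_of_mem (show ρ ∈ Ioi 0 from h0),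
        indicator_of_mem (show ρ ∈ Ioo 0 r from ⟨h0, h⟩)]
    · rw [indicator_of_notMem (fun h' : ρ ∈ Ioo 0 r => h h'.2),
        indicator_of_mem (show ρ ∈ Ioi 0 from h0),
        lineMiss_of_le lp (fun x hx => missProb_of_le p hx) ((not_lt.1 h).trans (le_abs_self ρ)),
        tsub_self]
  · rw [indicator_of_notMem (show ρ ∉ Ioi 0 from h0),
      indicator_of_notMem (fun h' : ρ ∈ Ioo 0 r => h0 h'.1)]

lemma lintegral_one_sub_lineMiss_ne_top (hp : Measurable p) (lp : ℝ) {ll : ℝ} (hll : 0 ≤ ll)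
    (r : ℝ) :
    ∫⁻ l, (1 - lineMiss lp (missProb p r) l.1) ∂lineIntensity ll ≠ ∞ := by
  rw [lintegral_one_sub_lineMiss hp _ hll _]
  refine ENNReal.mul_ne_top ENNReal.ofReal_ne_top ?_
  refine ne_top_of_le_ne_top (b := ∫⁻ ρ in Ioo 0 r, 1) ?_ (lintegral_mono fun t => tsub_le_self)
  simp

/-- Tonelli on the triangle `0 < ρ < s < r`. This makes the general exponent a primitive of its rate
without differentiating under an integral whose integrand is singular at `ρ = s`. -/
lemma lintegral_one_sub_lineMiss_eq_coxHazard (hp : Measurable p) (hp1 : ∀ x, p x ≤ 1)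
    (hlp : 0 ≤ lp) {ll : ℝ} (hll : 0 ≤ ll) {r : ℝ} (hr : 0 ≤ r) :
    ∫⁻ l, (1 - lineMiss lp (missProb p r) l.1) ∂lineIntensity ll =
      ∫⁻ s in Ioo 0 r, coxHazard ll lp p s := by
  rw [lintegral_one_sub_lineMiss hp _ hll _]
  unfold coxHazard
  rw [lintegral_const_mul' _ _ ENNReal.ofReal_ne_top]
  congr 1
  rw [setLIntegral_congr_fun measurableSet_Ioo fun ρ hρ =>
    one_sub_lineMiss_missProb hp hp1 hlp hρ.1.le hr]
  have hset : MeasurableSet {x : ℝ × ℝ | 0 < x.1 ∧ x.1 < x.2 ∧ x.2 < r} :=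
    (measurableSet_lt measurable_const measurable_fst).inter
      ((measurableSet_lt measurable_fst measurable_snd).inter
        (measurableSet_lt measurable_snd measurable_const))
  have hm := (measurable_lineHazard_mul (lp := lp) hp).indicator hset
  have hswap := lintegral_lintegral_swap (μ := (volume : Measure ℝ)) (ν := (volume : Measure ℝ))
    (f := fun ρ s => {x : ℝ × ℝ | 0 < x.1 ∧ x.1 < x.2 ∧ x.2 < r}.indicator
      (fun x => lineHazard lp p x.1 x.2 * lineMiss lp (missProb p x.2) x.1) (ρ, s))
    hm.aemeasurable
  convert hswap using 1
  · rw [← lintegral_indicator measurableSet_Ioo]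
    refine lintegral_congr fun ρ => ?_
    by_cases h : ρ ∈ Ioo 0 r
    · rw [indicator_of_mem h, ← lintegral_indicator measurableSet_Ioo]
      refine lintegral_congr fun s => ?_
      have : (ρ, s) ∈ {x : ℝ × ℝ | 0 < x.1 ∧ x.1 < x.2 ∧ x.2 < r} ↔ s ∈ Ioo ρ r :=
        ⟨fun h' => h'.2, fun h' => ⟨h.1, h'⟩⟩
      by_cases hs : s ∈ Ioo ρ r
      · rw [indicator_of_mem hs, indicator_of_mem (this.2 hs)]
      · rw [indicator_of_notMem hs, indicator_of_notMem (fun h' => hs (this.1 h'))]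
    · rw [indicator_of_notMem h]
      symm
      refine (lintegral_congr fun s => indicator_of_notMem ?_ _).trans lintegral_zero
      exact fun h' => h ⟨h'.1, h'.2.1.trans h'.2.2⟩
  · rw [← lintegral_indicator measurableSet_Ioo]
    refine lintegral_congr fun s => ?_
    by_cases h : s ∈ Ioo 0 r
    · rw [indicator_of_mem h, ← lintegral_indicator measurableSet_Ioo]
      refine lintegral_congr fun ρ => ?_
      have : (ρ, s) ∈ {x : ℝ × ℝ | 0 < x.1 ∧ x.1 < x.2 ∧ x.2 < r} ↔ ρ ∈ Ioo 0 s :=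
        ⟨fun h' => ⟨h'.1, h'.2.1⟩, fun h' => ⟨h'.1, h'.2, h.2⟩⟩
      by_cases hs : ρ ∈ Ioo 0 s
      · rw [indicator_of_mem hs, indicator_of_mem (this.2 hs)]
      · rw [indicator_of_notMem hs, indicator_of_notMem (fun h' => hs (this.1 h'))]
    · rw [indicator_of_notMem h]
      symm
      refine (lintegral_congr fun ρ => indicator_of_notMem ?_ _).trans lintegral_zero
      exact fun h' => h ⟨h'.1.trans h'.2.1, h'.2.2⟩

/-! ### The explicit formulas -/

lemma lineVoid_pos (lp : ℝ) (p : ℝ → ℝ) (r ρ : ℝ) : 0 < lineVoid lp p r ρ := Real.exp_pos _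

lemma measurable_lineVoid (hp : Measurable p) (hp0 : ∀ x, 0 ≤ p x) (hp1 : ∀ x, p x ≤ 1)
    (hlp : 0 ≤ lp) {r : ℝ} (hr : 0 ≤ r) : Measurable (lineVoid lp p r) := by
  have h : lineVoid lp p r = fun ρ => (lineMiss lp (missProb p r) ρ).toReal := by
    funext ρ
    rw [lineMiss_missProb_eq_lineVoid hp hp0 hp1 hlp ρ hr,
      ENNReal.toReal_ofReal (lineVoid_pos _ _ _ _).le]
  rw [h]
  exact (measurable_lineMiss lp (measurable_missProb hp r)).ennreal_toReal

lemma toReal_lintegral_one_sub_lineMiss (hp : Measurable p) (hp0 : ∀ x, 0 ≤ p x)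
    (hp1 : ∀ x, p x ≤ 1) (hlp : 0 ≤ lp) {ll : ℝ} (hll : 0 ≤ ll) {r : ℝ} (hr : 0 ≤ r) :
    (∫⁻ l, (1 - lineMiss lp (missProb p r) l.1) ∂lineIntensity ll).toReal =
      generalTerm ll lp p r := by
  have hle : ∀ ρ, lineVoid lp p r ρ ≤ 1 := by
    intro ρ
    have := expNeg_le_one (∫⁻ t, (1 - missProb p r (Real.sqrt (ρ ^ 2 + t ^ 2)))
      ∂(ENNReal.ofReal lp • (volume : Measure ℝ)))
    rwa [← lineMiss, lineMiss_missProb_eq_lineVoid hp hp0 hp1 hlp ρ hr,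
      ENNReal.ofReal_le_one] at this
  rw [lintegral_one_sub_lineMiss hp _ hll _, ENNReal.toReal_mul,
    ENNReal.toReal_ofReal (by positivity), generalTerm, intervalIntegral.integral_of_le hr,
    integral_Ioc_eq_integral_Ioo, integral_eq_lintegral_of_nonneg_ae]
  · congr 2
    refine lintegral_congr fun ρ => ?_
    rw [lineMiss_missProb_eq_lineVoid hp hp0 hp1 hlp ρ hr,
      ENNReal.ofReal_sub _ (lineVoid_pos _ _ _ _).le, ENNReal.ofReal_one]
  · exact Eventually.of_forall fun ρ => sub_nonneg.2 (hle ρ)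
  · exact (measurable_const.sub (measurable_lineVoid hp hp0 hp1 hlp hr)).aestronglyMeasurable

/-- No integrability is needed: an infinite `lintegral` has `toReal` equal to `0`, which is also the
Bochner integral of a non-integrable function. -/
lemma toReal_coxHazard (hp : Measurable p) (hp0 : ∀ x, 0 ≤ p x)
    (hp1 : ∀ x, p x ≤ 1) (hlp : 0 ≤ lp) {ll : ℝ} (hll : 0 ≤ ll) {r : ℝ} (hr : 0 ≤ r) :
    (coxHazard ll lp p r).toReal = generalRate ll lp p r := by
  rw [coxHazard, ENNReal.toReal_mul, ENNReal.toReal_ofReal (by positivity), generalRate,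
    intervalIntegral.integral_of_le hr, integral_Ioc_eq_integral_Ioo,
    integral_eq_lintegral_of_nonneg_ae]
  · congr 2
    refine lintegral_congr fun ρ => ?_
    have h1 : 0 ≤ 2 * lp * (r / Real.sqrt (r ^ 2 - ρ ^ 2)) * p r :=
      mul_nonneg (by positivity) (hp0 r)
    rw [lineMiss_missProb_eq_lineVoid hp hp0 hp1 hlp ρ hr, lineHazard, ENNReal.ofReal_mul h1]
  · exact Eventually.of_forall fun ρ => mul_nonneg (mul_nonneg (by positivity) (hp0 r))
      (lineVoid_pos _ _ _ _).le
  · have := measurable_lineVoid hp hp0 hp1 hlp hr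
    exact Measurable.aestronglyMeasurable (by fun_prop)

lemma generalRate_nonneg (hp : Measurable p) (hp0 : ∀ x, 0 ≤ p x)
    (hp1 : ∀ x, p x ≤ 1) (hlp : 0 ≤ lp) {ll : ℝ} (hll : 0 ≤ ll) {r : ℝ} (hr : 0 ≤ r) :
    0 ≤ generalRate ll lp p r := by
  rw [← toReal_coxHazard hp hp0 hp1 hlp hll hr]
  exact ENNReal.toReal_nonneg

/-- With `sin θ = y / r`, the half-chord is `r cos θ` and the distance of the line is `r sin θ`. -/
lemma toReal_lintegral_typical_line (hp : Measurable p) (hp0 : ∀ x, 0 ≤ p x)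
    (hp1 : ∀ x, p x ≤ 1) (hlp : 0 ≤ lp) {y r : ℝ} (hy : 0 ≤ y) (hyr : y ≤ r) :
    (∫⁻ t, (1 - missProb p r (Real.sqrt (y ^ 2 + t ^ 2))) ∂(ENNReal.ofReal lp • volume)).toReal =
      typicalTerm lp p r (Real.arcsin (y / r)) := by
  have hr : 0 ≤ r := hy.trans hyr
  rw [toReal_lintegral_one_sub_missProb_line hp hp0 hp1 hlp y hr, typicalTerm]
  rcases hr.eq_or_lt with h0 | h0
  · have : y = 0 := by linarith
    subst this
    simp [← h0]
  have hdiv : y / r ≤ 1 := (div_le_one h0).2 hyr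
  rw [Real.sin_arcsin (by linarith [div_nonneg hy hr]) hdiv, Real.cos_arcsin]
  have h1 : r * Real.sqrt (1 - (y / r) ^ 2) = Real.sqrt (r ^ 2 - y ^ 2) := by
    rw [← Real.sqrt_sq hr, ← Real.sqrt_mul (sq_nonneg r), Real.sqrt_sq hr]
    congr 1
    field_simp
  have h2 : r ^ 2 * (y / r) ^ 2 = y ^ 2 := by field_simp
  rw [h1]
  simp_rw [h2, add_comm (y ^ 2)]

/-- Here `r / √(r² - y²) = 1 / cos θ`; for `r ≤ |y|`, in particular at tangency, both sides are `0`
through division by zero. -/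
lemma lineHazard_eq_cos_arcsin (y : ℝ) {r : ℝ} (hr : 0 < r) :
    lineHazard lp p y r = ENNReal.ofReal (2 * lp * p r / Real.cos (Real.arcsin (y / r))) := by
  have h1 : Real.sqrt (r ^ 2 - y ^ 2) = r * Real.sqrt (1 - (y / r) ^ 2) := by
    rw [← Real.sqrt_sq hr.le, ← Real.sqrt_mul (sq_nonneg r), Real.sqrt_sq hr.le]
    congr 1
    field_simp
  rw [lineHazard, Real.cos_arcsin, h1, div_mul_cancel_left₀ hr.ne']
  congr 1
  ring

end Line

/-! ### The nearest terrestrial base station -/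

/-- The hazard rate of the distance to the nearest marked point of a planar Poisson process. -/
def planarHazard (ltb : ℝ) (p : ℝ → ℝ) (s : ℝ) : ℝ≥0∞ :=
  ENNReal.ofReal (2 * Real.pi * ltb * s * p s)

section Terrestrial

variable {p : ℝ → ℝ} {ltb : ℝ}

lemma measurable_planarHazard (hp : Measurable p) : Measurable (planarHazard ltb p) := by
  unfold planarHazard
  fun_prop

lemma integrableOn_id_mul (hp : Measurable p) (hp0 : ∀ x, 0 ≤ p x) (hp1 : ∀ x, p x ≤ 1) (r : ℝ) :
    IntegrableOn (fun z => z * p z) (Ioo 0 r) := by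
  refine Measure.integrableOn_of_bounded (M := r) (by simp) (by fun_prop) ?_
  filter_upwards [ae_restrict_mem measurableSet_Ioo] with z hz
  rw [Real.norm_eq_abs, abs_of_nonneg (mul_nonneg hz.1.le (hp0 z))]
  nlinarith [hz.1, hz.2, hp0 z, hp1 z]

lemma lintegral_planarHazard (hp : Measurable p) (hp0 : ∀ x, 0 ≤ p x) (hp1 : ∀ x, p x ≤ 1)
    (hltb : 0 ≤ ltb) {r : ℝ} (hr : 0 ≤ r) :
    ∫⁻ s in Ioo 0 r, planarHazard ltb p s =
      ENNReal.ofReal (2 * Real.pi * ltb * ∫ z in (0 : ℝ)..r, z * p z) := by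
  rw [intervalIntegral.integral_of_le hr, integral_Ioc_eq_integral_Ioo,
    ENNReal.ofReal_mul (by positivity), ofReal_integral_eq_lintegral_ofReal
      (integrableOn_id_mul hp hp0 hp1 r), ← lintegral_const_mul' _ _ ENNReal.ofReal_ne_top]
  · refine lintegral_congr fun s => ?_
    rw [planarHazard, mul_assoc, ENNReal.ofReal_mul (by positivity)]
  · filter_upwards [ae_restrict_mem measurableSet_Ioo] with z hz
    exact mul_nonneg hz.1.le (hp0 z)

lemma lintegral_planarHazard_ne_top (hp : Measurable p) (hp0 : ∀ x, 0 ≤ p x)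
    (hp1 : ∀ x, p x ≤ 1) (hltb : 0 ≤ ltb) (r : ℝ) :
    ∫⁻ s in Ioo 0 r, planarHazard ltb p s ≠ ∞ := by
  rcases le_or_gt 0 r with hr | hr
  · rw [lintegral_planarHazard hp hp0 hp1 hltb hr]
    exact ENNReal.ofReal_ne_top
  · simp [Ioo_eq_empty (not_lt.2 hr.le)]

lemma integral_id_mul_nonneg (hp0 : ∀ x, 0 ≤ p x) {r : ℝ} (hr : 0 ≤ r) :
    0 ≤ ∫ z in (0 : ℝ)..r, z * p z :=
  intervalIntegral.integral_nonneg hr fun z hz => mul_nonneg hz.1 (hp0 z)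

lemma expNeg_lintegral_planarHazard (hp : Measurable p) (hp0 : ∀ x, 0 ≤ p x)
    (hp1 : ∀ x, p x ≤ 1) (hltb : 0 ≤ ltb) {r : ℝ} (hr : 0 ≤ r) :
    expNeg (∫⁻ s in Ioo 0 r, planarHazard ltb p s) =
      ENNReal.ofReal (Real.exp (-(2 * Real.pi * ltb * ∫ z in (0 : ℝ)..r, z * p z))) := by
  rw [lintegral_planarHazard hp hp0 hp1 hltb hr, expNeg, ENNReal.toReal_ofReal]
  exact mul_nonneg (by positivity) (integral_id_mul_nonneg hp0 hr)

/-- The mean number of marked points in the disc of radius `r`, in polar coordinates. -/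
lemma lintegral_one_sub_missProb_plane (hp : Measurable p) (hp0 : ∀ x, 0 ≤ p x)
    (hp1 : ∀ x, p x ≤ 1) (hltb : 0 ≤ ltb) {r : ℝ} (hr : 0 ≤ r) :
    ∫⁻ v : Plane, (1 - missProb p r ‖v‖) ∂(ENNReal.ofReal ltb • volume) =
      ∫⁻ s in Ioo 0 r, planarHazard ltb p s := by
  -- Polar coordinates: the dimension `2` times the area `π` of the unit disc supplies the factor
  -- `2π`.
  have hpol := integral_fun_norm_addHaar (volume : Measure Plane) ((Iio r).indicator p)
  have hnonneg : ∀ x, 0 ≤ (Iio r).indicator p x := fun x => indicator_nonneg (fun x _ => hp0 x) x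
  have hm : Measurable ((Iio r).indicator p) := hp.indicator measurableSet_Iio
  have hle : ∀ x, (Iio r).indicator p x ≤ 1 := fun x =>
    (indicator_le_self' (fun x _ => hp0 x) x).trans (hp1 x)
  have hint : Integrable (fun v : Plane => (Iio r).indicator p ‖v‖) := by
    have h1 : IntegrableOn (fun v : Plane => (Iio r).indicator p ‖v‖) (Metric.ball 0 r) := by
      refine Measure.integrableOn_of_bounded (M := 1) measure_ball_lt_top.ne
        (hm.comp measurable_norm).aestronglyMeasurable (Eventually.of_forall fun v => ?_)
      rw [Real.norm_eq_abs, abs_of_nonneg (hnonneg _)]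
      exact hle _
    refine (integrableOn_iff_integrable_of_support_subset fun v hv => ?_).1 h1
    rw [mem_ball_zero_iff]
    by_contra h
    exact hv (indicator_of_notMem (show ‖v‖ ∉ Iio r from h) _)
  have hrad : ∫ x in Ioi (0 : ℝ), x ^ (Module.finrank ℝ Plane - 1) • (Iio r).indicator p x =
      ∫ z in (0 : ℝ)..r, z * p z := by
    rw [intervalIntegral.integral_of_le hr, integral_Ioc_eq_integral_Ioo,
      ← integral_indicator measurableSet_Ioi, ← integral_indicator measurableSet_Ioo]
    refine integral_congr_ae (Eventually.of_forall fun x => ?_)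
    by_cases h0 : 0 < x <;> by_cases h1 : x < r <;> simp [indicator, h0, h1]
  have hball : (volume : Measure Plane).real (Metric.ball 0 1) = Real.pi := by
    rw [measureReal_def, EuclideanSpace.volume_ball_fin_two]
    simp [Real.pi_pos.le]
  have hfr : Module.finrank ℝ Plane = 2 := by simp
  rw [hrad, hball, hfr] at hpol
  rw [lintegral_smul_measure, lintegral_planarHazard hp hp0 hp1 hltb hr]
  have hpt : ∀ v : Plane, 1 - missProb p r ‖v‖ = ENNReal.ofReal ((Iio r).indicator p ‖v‖) := by
    intro v
    rw [one_sub_missProb hp1]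
    by_cases h : ‖v‖ < r <;> simp [indicator, h]
  simp_rw [hpt]
  rw [← ofReal_integral_eq_lintegral_ofReal hint (Eventually.of_forall fun v => hnonneg _), hpol,
    smul_eq_mul, ← ENNReal.ofReal_mul hltb]
  congr 1
  simp only [smul_eq_mul, nsmul_eq_mul, Nat.cast_ofNat]
  ring

lemma exists_le_toReal_lintegral_planarHazard (hp : Measurable p) (hp1 : ∀ x, p x ≤ 1)
    {ε : ℝ} (hε : 0 < ε) (hpε : ∀ x, ε ≤ p x) (hltb : 0 < ltb) (M : ℝ) :
    ∃ r : ℝ, 0 ≤ r ∧ M ≤ (∫⁻ s in Ioo 0 r, planarHazard ltb p s).toReal := by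
  have hp0 : ∀ x, 0 ≤ p x := fun x => hε.le.trans (hpε x)
  set K := 2 * Real.pi * ltb * (ε / 2) with hK
  have hKpos : 0 < K := by positivity
  -- The cumulative hazard is at least `K r²`. The summand `1` ensures `r ≤ r²`, and the other gives
  -- `K r ≥ |M|`.
  refine ⟨1 + |M| / K, by positivity, ?_⟩
  set r := 1 + |M| / K with hr
  have hr1 : 1 ≤ r := le_add_of_nonneg_right (by positivity)
  have hr0 : 0 ≤ r := zero_le_one.trans hr1
  rw [lintegral_planarHazard hp hp0 hp1 hltb.le hr0,
    ENNReal.toReal_ofReal (mul_nonneg (by positivity) (integral_id_mul_nonneg hp0 hr0))]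
  have h1 : ε / 2 * r ^ 2 ≤ ∫ z in (0 : ℝ)..r, z * p z := by
    have h2 : ∫ z in (0 : ℝ)..r, z * ε = ε / 2 * r ^ 2 := by
      rw [intervalIntegral.integral_mul_const, integral_id]
      ring
    rw [← h2]
    refine intervalIntegral.integral_mono_on hr0 (Continuous.intervalIntegrable (by fun_prop) _ _)
      ?_ fun z hz => mul_le_mul_of_nonneg_left (hpε z) hz.1
    rw [intervalIntegrable_iff_integrableOn_Ioo_of_le hr0]
    exact integrableOn_id_mul hp hp0 hp1 r
  have h3 : K * r ^ 2 ≤ 2 * Real.pi * ltb * ∫ z in (0 : ℝ)..r, z * p z := by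
    rw [hK, mul_assoc]
    exact mul_le_mul_of_nonneg_left h1 (by positivity)
  refine le_trans ?_ h3
  have h4 : |M| = K * (|M| / K) := by field_simp
  calc M ≤ |M| := le_abs_self M
    _ = K * (|M| / K) := h4
    _ ≤ K * r := mul_le_mul_of_nonneg_left (by linarith) hKpos.le
    _ ≤ K * r ^ 2 := mul_le_mul_of_nonneg_left (by nlinarith) hKpos.le

variable {Ω : Type*} [MeasurableSpace Ω] {μ : Measure Ω} [IsProbabilityMeasure μ]
  {X : ℕ → Ω → Plane} {S : ℕ → Set Ω}

lemma measure_le_nearestDist_planar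
    (hX : IsPPP X (ENNReal.ofReal ltb • (volume : Measure Plane)) μ) (hS : IsLoSMarking X S p μ)
    (hp : Measurable p) (hp0 : ∀ x, 0 ≤ p x) (hp1 : ∀ x, p x ≤ 1) (hltb : 0 ≤ ltb) {r : ℝ}
    (hr : 0 ≤ r) :
    μ {ω | ENNReal.ofReal r ≤ nearestDist X S ω} =
      expNeg (∫⁻ s in Ioo 0 r, planarHazard ltb p s) := by
  rw [hS.measure_le_nearestDist hX.measurable hp hp1 Finset.range_mono
    (fun i => ⟨i + 1, by simp⟩) r, ← lintegral_one_sub_missProb_plane hp hp0 hp1 hltb hr]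
  refine hX.lintegral_infProd (g := fun v : Plane => missProb p r ‖v‖)
    ((measurable_missProb hp r).comp measurable_norm) (fun v => missProb_le_one _ _ _) ?_
  have hsub : {v : Plane | missProb p r ‖v‖ ≠ 1} ⊆ Metric.ball 0 r := by
    intro v hv
    rw [mem_ball_zero_iff]
    exact not_le.1 fun h => hv (missProb_of_le p h)
  refine ne_top_of_le_ne_top ?_ (measure_mono hsub)
  rw [Measure.smul_apply, smul_eq_mul]
  exact ENNReal.mul_ne_top ENNReal.ofReal_ne_top measure_ball_lt_top.ne

/-- The distribution of the distance to the nearest marked point of a planar Poisson process. -/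
theorem nearestDist_planar
    (hX : IsPPP X (ENNReal.ofReal ltb • (volume : Measure Plane)) μ) (hS : IsLoSMarking X S p μ)
    (hp : Measurable p) (hp1 : ∀ x, p x ≤ 1) {ε : ℝ} (hε : 0 < ε) (hpε : ∀ x, ε ≤ p x)
    (hltb : 0 < ltb) :
    (Measurable (nearestDist X S) ∧ ∀ᵐ ω ∂μ, nearestDist X S ω ≠ ∞) ∧
      (∀ r : ℝ, 0 ≤ r → μ {ω | nearestDist X S ω ≤ ENNReal.ofReal r} =
        ENNReal.ofReal (cdfTB ltb p r)) ∧
      μ.map (fun ω => (nearestDist X S ω).toReal) =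
        volume.withDensity fun r => ENNReal.ofReal (if r ≤ 0 then 0 else pdfTB ltb p r) := by
  have hp0 : ∀ x, 0 ≤ p x := fun x => hε.le.trans (hpε x)
  have hR := measurable_nearestDist hX.measurable hS.measurableSet
  have hu := measurable_planarHazard (ltb := ltb) hp
  have hfin := lintegral_planarHazard_ne_top hp hp0 hp1 hltb.le
  have hsurv := fun r hr => measure_le_nearestDist_planar hX hS hp hp0 hp1 hltb.le (r := r) hr
  have hlim := exists_le_toReal_lintegral_planarHazard hp hp1 hε hpε hltb
  refine ⟨⟨hR, ae_ne_top_of_survival hsurv hlim⟩, fun r hr => ?_, ?_⟩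
  · rw [measure_le_eq_of_survival hR hu hfin hsurv hlim hr,
      expNeg_lintegral_planarHazard hp hp0 hp1 hltb.le hr, cdfTB,
      ENNReal.ofReal_sub _ (Real.exp_nonneg _), ENNReal.ofReal_one]
  · rw [map_toReal_eq_withDensity hR hu hfin hsurv hlim]
    congr 1
    funext r
    split_ifs with h
    · simp
    · have hr : 0 < r := not_le.1 h
      rw [expNeg_lintegral_planarHazard hp hp0 hp1 hltb.le hr.le, planarHazard, pdfTB,
        ENNReal.ofReal_mul (mul_nonneg (by positivity) (hp0 r))]

end Terrestrial

/-! ### The nearest dedicated base station -/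

section Dedicated

variable {p : ℝ → ℝ} {ll lp y : ℝ}

/-- The hazard rate of the distance to the nearest marked point on all the lines, the typical one
being at distance `y`. -/
def totalHazard (ll lp y : ℝ) (p : ℝ → ℝ) (s : ℝ) : ℝ≥0∞ :=
  lineHazard lp p y s + coxHazard ll lp p s

lemma measurable_totalHazard (hp : Measurable p) : Measurable (totalHazard ll lp y p) :=
  ((measurable_lineHazard hp).comp measurable_prodMk_left).add (measurable_coxHazard hp ll)

/-- Since `lineHazard` vanishes up to `y`, integrating it over `(0, r)` or `(y, r)` is the same; one
formula covers discs that do and do not reach the typical line. -/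
lemma lintegral_totalHazard (hp : Measurable p) (hp1 : ∀ x, p x ≤ 1) (hlp : 0 ≤ lp) (hll : 0 ≤ ll)
    (hy : 0 ≤ y) {r : ℝ} (hr : 0 ≤ r) :
    ∫⁻ s in Ioo 0 r, totalHazard ll lp y p s =
      (∫⁻ t, (1 - missProb p r (Real.sqrt (y ^ 2 + t ^ 2))) ∂(ENNReal.ofReal lp • volume)) +
      ∫⁻ l, (1 - lineMiss lp (missProb p r) l.1) ∂lineIntensity ll := by
  unfold totalHazard
  rw [lintegral_add_right _ (measurable_coxHazard hp ll),
    ← lintegral_one_sub_lineMiss_eq_coxHazard hp hp1 hlp hll hr,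
    lintegral_one_sub_missProb_line_eq_lineHazard hp1 hlp hy hr]
  congr 1
  rw [← lintegral_indicator measurableSet_Ioo, ← lintegral_indicator measurableSet_Ioo]
  refine lintegral_congr fun s => ?_
  by_cases h0 : 0 < s ∧ s < r
  · rw [indicator_of_mem (show s ∈ Ioo 0 r from h0)]
    by_cases h : y < s
    · rw [indicator_of_mem (show s ∈ Ioo y r from ⟨h, h0.2⟩)]
    · rw [indicator_of_notMem fun h' : s ∈ Ioo y r => h h'.1,
        lineHazard_of_le h0.1.le (not_lt.1 h)]
  · rw [indicator_of_notMem (show s ∉ Ioo 0 r from h0), indicator_of_notMem]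
    exact fun h' => h0 ⟨hy.trans_lt h'.1, h'.2⟩

lemma lintegral_totalHazard_ne_top (hp : Measurable p) (hp1 : ∀ x, p x ≤ 1) (hlp : 0 ≤ lp)
    (hll : 0 ≤ ll) (hy : 0 ≤ y) (r : ℝ) : ∫⁻ s in Ioo 0 r, totalHazard ll lp y p s ≠ ∞ := by
  rcases le_or_gt 0 r with hr | hr
  · rw [lintegral_totalHazard hp hp1 hlp hll hy hr]
    exact ENNReal.add_ne_top.2 ⟨lintegral_one_sub_missProb_line_ne_top hp1 y hr,
      lintegral_one_sub_lineMiss_ne_top hp _ hll _⟩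
  · simp [Ioo_eq_empty (not_lt.2 hr.le)]

lemma expNeg_lintegral_totalHazard (hp : Measurable p) (hp0 : ∀ x, 0 ≤ p x)
    (hp1 : ∀ x, p x ≤ 1) (hlp : 0 ≤ lp) (hll : 0 ≤ ll) (hy : 0 ≤ y) {r : ℝ} (hyr : y ≤ r) :
    expNeg (∫⁻ s in Ioo 0 r, totalHazard ll lp y p s) =
      ENNReal.ofReal (Real.exp (-typicalTerm lp p r (Real.arcsin (y / r)) -
        generalTerm ll lp p r)) := by
  have hr := hy.trans hyr
  rw [lintegral_totalHazard hp hp1 hlp hll hy hr, expNeg,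
    ENNReal.toReal_add (lintegral_one_sub_missProb_line_ne_top hp1 y hr)
      (lintegral_one_sub_lineMiss_ne_top hp _ hll _),
    toReal_lintegral_typical_line hp hp0 hp1 hlp hy hyr,
    toReal_lintegral_one_sub_lineMiss hp hp0 hp1 hlp hll hr, neg_add']

lemma expNeg_lintegral_totalHazard_of_lt (hp : Measurable p) (hp0 : ∀ x, 0 ≤ p x)
    (hp1 : ∀ x, p x ≤ 1) (hlp : 0 ≤ lp) (hll : 0 ≤ ll) {r : ℝ} (hr : 0 ≤ r) (hry : r < y) :
    expNeg (∫⁻ s in Ioo 0 r, totalHazard ll lp y p s) =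
      ENNReal.ofReal (Real.exp (-generalTerm ll lp p r)) := by
  have hy : 0 ≤ y := hr.trans hry.le
  rw [lintegral_totalHazard hp hp1 hlp hll hy hr,
    lintegral_one_sub_missProb_line_eq_lineHazard hp1 hlp hy hr,
    Ioo_eq_empty (not_lt.2 hry.le), Measure.restrict_empty, lintegral_zero_measure, zero_add,
    expNeg, toReal_lintegral_one_sub_lineMiss hp hp0 hp1 hlp hll hr]

lemma exists_le_toReal_lintegral_totalHazard (hp : Measurable p) (hp1 : ∀ x, p x ≤ 1)
    {ε : ℝ} (hε : 0 < ε) (hpε : ∀ x, ε ≤ p x) (hlp : 0 < lp) (hll : 0 ≤ ll) (hy : 0 ≤ y) (M : ℝ) :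
    ∃ r : ℝ, 0 ≤ r ∧ M ≤ (∫⁻ s in Ioo 0 r, totalHazard ll lp y p s).toReal := by
  have hp0 : ∀ x, 0 ≤ p x := fun x => hε.le.trans (hpε x)
  set K := 2 * lp * ε with hK
  have hKpos : 0 < K := by positivity
  -- Chosen so that the half-chord on the typical line is `|M| / K`; that line alone makes the
  -- hazard large enough.
  set r := Real.sqrt (y ^ 2 + (|M| / K) ^ 2) with hr
  have hr0 : 0 ≤ r := Real.sqrt_nonneg _
  have hsq : Real.sqrt (r ^ 2 - y ^ 2) = |M| / K := by
    rw [hr, Real.sq_sqrt (by positivity), add_sub_cancel_left, Real.sqrt_sq (by positivity)]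
  refine ⟨r, hr0, ?_⟩
  rw [lintegral_totalHazard hp hp1 hlp.le hll hy hr0,
    ENNReal.toReal_add (lintegral_one_sub_missProb_line_ne_top hp1 y hr0)
      (lintegral_one_sub_lineMiss_ne_top hp _ hll _),
    toReal_lintegral_one_sub_missProb_line hp hp0 hp1 hlp.le y hr0, hsq]
  have hint : IntervalIntegrable (fun z => p (Real.sqrt (y ^ 2 + z ^ 2))) volume 0 (|M| / K) := by
    rw [intervalIntegrable_iff_integrableOn_Ioo_of_le (by positivity)]
    refine Measure.integrableOn_of_bounded (M := 1) (by simp)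
      (hp.comp (by fun_prop)).aestronglyMeasurable (Eventually.of_forall fun z => ?_)
    rw [Real.norm_eq_abs, abs_of_nonneg (hp0 _)]
    exact hp1 _
  have h1 : |M| / K * ε ≤ ∫ z in (0 : ℝ)..|M| / K, p (Real.sqrt (y ^ 2 + z ^ 2)) := by
    have h2 : ∫ _ in (0 : ℝ)..|M| / K, ε = |M| / K * ε := by simp
    rw [← h2]
    exact intervalIntegral.integral_mono_on (by positivity) (by simp) hint fun z _ => hpε _
  have h3 : |M| = 2 * lp * (|M| / K * ε) := by
    rw [hK]
    field_simp
  calc M ≤ |M| := le_abs_self M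
    _ = 2 * lp * (|M| / K * ε) := h3
    _ ≤ 2 * lp * ∫ z in (0 : ℝ)..|M| / K, p (Real.sqrt (y ^ 2 + z ^ 2)) :=
        mul_le_mul_of_nonneg_left h1 (by positivity)
    _ ≤ _ := le_add_of_nonneg_right ENNReal.toReal_nonneg

/-- The hazard has finite integral over each `(0, n)`. Finiteness almost everywhere is enough to
identify a density. -/
lemma ae_coxHazard_ne_top (hp : Measurable p) (hp1 : ∀ x, p x ≤ 1) (hlp : 0 ≤ lp) (hll : 0 ≤ ll) :
    ∀ᵐ s : ℝ, 0 < s → coxHazard ll lp p s ≠ ∞ := by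
  have h : ∀ n : ℕ, ∀ᵐ s : ℝ, s ∈ Ioo (0 : ℝ) n → coxHazard ll lp p s ≠ ∞ := by
    intro n
    have hn : (0 : ℝ) ≤ n := Nat.cast_nonneg n
    have hfin := lintegral_one_sub_lineMiss_ne_top hp lp hll n
    rw [lintegral_one_sub_lineMiss_eq_coxHazard hp hp1 hlp hll hn] at hfin
    have := ae_lt_top (measurable_coxHazard hp ll) hfin
    filter_upwards [(ae_restrict_iff' measurableSet_Ioo).1 this] with s hs h
    exact (hs h).ne
  filter_upwards [ae_all_iff.2 h] with s hs h0
  obtain ⟨n, hn⟩ := exists_nat_gt s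
  exact hs n ⟨h0, hn⟩

lemma totalHazard_mul_expNeg (hp : Measurable p) (hp0 : ∀ x, 0 ≤ p x) (hp1 : ∀ x, p x ≤ 1)
    (hlp : 0 ≤ lp) (hll : 0 ≤ ll) (hy : 0 ≤ y) {r : ℝ} (hr : 0 < r)
    (hfin : coxHazard ll lp p r ≠ ∞) :
    totalHazard ll lp y p r * expNeg (∫⁻ s in Ioo 0 r, totalHazard ll lp y p s) =
      ENNReal.ofReal (if r < y then pdfDBShort ll lp p r
        else pdfDB ll lp p r (Real.arcsin (y / r))) := by
  have hrate := generalRate_nonneg hp hp0 hp1 hlp hll hr.le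
  have hcox : coxHazard ll lp p r = ENNReal.ofReal (generalRate ll lp p r) := by
    rw [← toReal_coxHazard hp hp0 hp1 hlp hll hr.le, ENNReal.ofReal_toReal hfin]
  split_ifs with h
  · rw [expNeg_lintegral_totalHazard_of_lt hp hp0 hp1 hlp hll hr.le h, totalHazard,
      lineHazard_of_le hr.le h.le, zero_add, hcox, pdfDBShort, ENNReal.ofReal_mul hrate]
  · have hcos : 0 ≤ 2 * lp * p r / Real.cos (Real.arcsin (y / r)) :=
      div_nonneg (mul_nonneg (by positivity) (hp0 r)) (Real.cos_arcsin_nonneg _)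
    rw [expNeg_lintegral_totalHazard hp hp0 hp1 hlp hll hy (not_lt.1 h), totalHazard,
      lineHazard_eq_cos_arcsin y hr, hcox, pdfDB, ENNReal.ofReal_mul (add_nonneg hcos hrate),
      ENNReal.ofReal_add hcos hrate]

variable {Ω : Type*} [MeasurableSpace Ω] {μ : Measure Ω} [IsProbabilityMeasure μ]
  {L : ℕ → Ω → ℝ × ℝ} {T : Option ℕ → ℕ → Ω → ℝ} {φ₀ : ℝ} {S : Option ℕ × ℕ → Set Ω}

lemma measure_le_nearestDist_cox (hLT : IsPLCP L T ll lp μ)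
    (hS : IsLoSMarking (coxPoint L T y φ₀) S p μ)
    (hp : Measurable p) (hp1 : ∀ x, p x ≤ 1) (hlp : 0 ≤ lp) (hll : 0 ≤ ll) (hy : 0 ≤ y) {r : ℝ}
    (hr : 0 ≤ r) :
    μ {ω | ENNReal.ofReal r ≤ nearestDist (coxPoint L T y φ₀) S ω} =
      expNeg (∫⁻ s in Ioo 0 r, totalHazard ll lp y p s) := by
  have hmono : Monotone fun n : ℕ => firstLines n ×ˢ Finset.range n := fun m n hmn =>
    Finset.product_subset_product (monotone_firstLines hmn) (Finset.range_mono hmn)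
  have hcover : ∀ i : Option ℕ × ℕ, ∃ n, i ∈ firstLines n ×ˢ Finset.range n := by
    rintro ⟨o, k⟩
    cases o with
    | none => exact ⟨k + 1, by simp [firstLines]⟩
    | some j => exact ⟨j + k + 1, by simp [firstLines]⟩
  rw [hS.measure_le_nearestDist (measurable_coxPoint hLT y φ₀) hp hp1 hmono hcover r,
    hLT.lintegral_iInf_prod y φ₀ (measurable_missProb hp r) (missProb_le_one p r)
      (fun x hx => missProb_of_le p hx), lintegral_totalHazard hp hp1 hlp hll hy hr,
    expNeg_add (lintegral_one_sub_missProb_line_ne_top hp1 y hr)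
      (lintegral_one_sub_lineMiss_ne_top hp _ hll _), lineMiss]

/-- The distribution of the distance to the nearest marked point of the Cox process and the typical
line. -/
theorem nearestDist_cox (hLT : IsPLCP L T ll lp μ) (hS : IsLoSMarking (coxPoint L T y φ₀) S p μ)
    (hp : Measurable p) (hp1 : ∀ x, p x ≤ 1) {ε : ℝ} (hε : 0 < ε) (hpε : ∀ x, ε ≤ p x)
    (hlp : 0 < lp) (hll : 0 ≤ ll) (hy : 0 ≤ y) :
    (Measurable (nearestDist (coxPoint L T y φ₀) S) ∧
        ∀ᵐ ω ∂μ, nearestDist (coxPoint L T y φ₀) S ω ≠ ∞) ∧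
      (∀ r : ℝ, y ≤ r → μ {ω | nearestDist (coxPoint L T y φ₀) S ω ≤ ENNReal.ofReal r} =
        ENNReal.ofReal (cdfDB ll lp p r (Real.arcsin (y / r)))) ∧
      (∀ r : ℝ, 0 ≤ r → r < y →
        μ {ω | nearestDist (coxPoint L T y φ₀) S ω ≤ ENNReal.ofReal r} =
          ENNReal.ofReal (cdfDBShort ll lp p r)) ∧
      μ.map (fun ω => (nearestDist (coxPoint L T y φ₀) S ω).toReal) =
        volume.withDensity fun r => ENNReal.ofReal (if r ≤ 0 then 0
          else if r < y then pdfDBShort ll lp p r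
          else pdfDB ll lp p r (Real.arcsin (y / r))) := by
  have hp0 : ∀ x, 0 ≤ p x := fun x => hε.le.trans (hpε x)
  have hR := measurable_nearestDist (measurable_coxPoint hLT y φ₀) hS.measurableSet
  have hu := measurable_totalHazard (ll := ll) (lp := lp) (y := y) hp
  have hfin := lintegral_totalHazard_ne_top hp hp1 hlp.le hll hy
  have hsurv := fun r hr => measure_le_nearestDist_cox hLT hS hp hp1 hlp.le hll hy (r := r) hr
  have hlim := exists_le_toReal_lintegral_totalHazard hp hp1 hε hpε hlp hll hy
  refine ⟨⟨hR, ae_ne_top_of_survival hsurv hlim⟩, fun r hr => ?_, fun r hr hry => ?_, ?_⟩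
  · rw [measure_le_eq_of_survival hR hu hfin hsurv hlim (hy.trans hr),
      expNeg_lintegral_totalHazard hp hp0 hp1 hlp.le hll hy hr, cdfDB,
      ENNReal.ofReal_sub _ (Real.exp_nonneg _), ENNReal.ofReal_one]
  · rw [measure_le_eq_of_survival hR hu hfin hsurv hlim hr,
      expNeg_lintegral_totalHazard_of_lt hp hp0 hp1 hlp.le hll hr hry, cdfDBShort,
      ENNReal.ofReal_sub _ (Real.exp_nonneg _), ENNReal.ofReal_one]
  · rw [map_toReal_eq_withDensity hR hu hfin hsurv hlim]
    refine withDensity_congr_ae ?_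
    filter_upwards [ae_coxHazard_ne_top hp hp1 hlp.le hll] with r hr
    by_cases h : r ≤ 0
    · simp [h]
    · rw [if_neg h, if_neg h]
      exact totalHazard_mul_expNeg hp hp0 hp1 hlp.le hll hy (not_le.1 h) (hr (not_le.1 h))

end Dedicated

/-! ### The line-of-sight probability -/

section LoS

variable {a : ℝ} (b Δh : ℝ)

lemma measurable_losProb (a : ℝ) : Measurable (losProb a b Δh) := by
  unfold losProb
  fun_prop

/-- The elevation angle is at most `90` degrees in absolute value, so the exponent is bounded
uniformly in `r`. -/
lemma losProb_exponent_abs_le (a r : ℝ) :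
    |-b * (180 / Real.pi * Real.arctan (Δh / r) - a)| ≤ |b| * (90 + |a|) := by
  rw [abs_mul, abs_neg]
  refine mul_le_mul_of_nonneg_left ((abs_sub _ _).trans ?_) (abs_nonneg b)
  gcongr
  rw [abs_mul, abs_of_pos (by positivity)]
  have h : |Real.arctan (Δh / r)| ≤ Real.pi / 2 :=
    abs_le.2 ⟨(Real.neg_pi_div_two_lt_arctan _).le, (Real.arctan_lt_pi_div_two _).le⟩
  calc 180 / Real.pi * |Real.arctan (Δh / r)| ≤ 180 / Real.pi * (Real.pi / 2) :=
        mul_le_mul_of_nonneg_left h (by positivity)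
    _ = 90 := by
        field_simp
        norm_num

lemma losProb_pos (ha : 0 < a) (r : ℝ) : 0 < losProb a b Δh r := by
  unfold losProb
  positivity

lemma losProb_le_one (ha : 0 < a) (r : ℝ) : losProb a b Δh r ≤ 1 := by
  unfold losProb
  rw [div_le_one (by positivity)]
  exact le_add_of_nonneg_right (by positivity)

lemma measurable_linkProb (a : ℝ) (c : Link) : Measurable (linkProb a b Δh c) := by
  cases c with
  | los => exact measurable_losProb b Δh a
  | nlos => exact measurable_const.sub (measurable_losProb b Δh a)

lemma linkProb_le_one (ha : 0 < a) (c : Link) (r : ℝ) : linkProb a b Δh c r ≤ 1 := by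
  cases c with
  | los => exact losProb_le_one b Δh ha r
  | nlos => exact sub_le_self _ (losProb_pos b Δh ha r).le

/-- The link probabilities are bounded away from zero. -/
lemma exists_pos_le_linkProb (ha : 0 < a) (c : Link) :
    ∃ ε : ℝ, 0 < ε ∧ ∀ r, ε ≤ linkProb a b Δh c r := by
  set K := |b| * (90 + |a|)
  cases c with
  | los =>
    refine ⟨1 / (1 + a * Real.exp K), by positivity, fun r => ?_⟩
    change _ ≤ losProb a b Δh r
    unfold losProb
    have := (abs_le.1 (losProb_exponent_abs_le b Δh a r)).2
    gcongr
  | nlos =>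
    have hK : 0 < a * Real.exp (-K) := by positivity
    refine ⟨1 - 1 / (1 + a * Real.exp (-K)), ?_, fun r => ?_⟩
    · rw [sub_pos, div_lt_one (by positivity)]
      linarith
    · change _ ≤ 1 - losProb a b Δh r
      unfold losProb
      have := (abs_le.1 (losProb_exponent_abs_le b Δh a r)).1
      gcongr

end LoS

end UAVNetwork

end

theorem lemma1 {Ω : Type*} [MeasurableSpace Ω] (μ : Measure Ω) [IsProbabilityMeasure μ]
    (ltb ll lp : ℝ) (hltb : 0 < ltb) (hll : 0 < ll) (hlp : 0 < lp)
    (a b hu htb hdb : ℝ) (ha : 0 < a)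
    -- terrestrial base stations and their line-of-sight events
    (X : ℕ → Ω → UAVNetwork.Plane) (Stb : ℕ → Set Ω)
    (hX : UAVNetwork.IsPPP X (ENNReal.ofReal ltb • (volume : Measure UAVNetwork.Plane)) μ)
    (hStb : UAVNetwork.IsLoSMarking X Stb (UAVNetwork.losProb a b (hu - htb)) μ)
    -- dedicated base stations, typical line at distance y, and their line-of-sight events
    (y φ₀ : ℝ) (hy : 0 ≤ y)
    (L : ℕ → Ω → ℝ × ℝ) (T : Option ℕ → ℕ → Ω → ℝ) (Sdb : Option ℕ × ℕ → Set Ω)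
    (hLT : UAVNetwork.IsPLCP L T ll lp μ)
    (hSdb : UAVNetwork.IsLoSMarking (UAVNetwork.coxPoint L T y φ₀) Sdb
      (UAVNetwork.losProb a b (hu - hdb)) μ) :
    ∀ c : UAVNetwork.Link,
      ∀ Rtb Rdb : Ω → ℝ≥0∞,
      Rtb = UAVNetwork.nearestDist X (UAVNetwork.linkEvent Stb c) →
      Rdb = UAVNetwork.nearestDist (UAVNetwork.coxPoint L T y φ₀)
        (UAVNetwork.linkEvent Sdb c) →
      ∀ Ptb Pdb : ℝ → ℝ,
      Ptb = UAVNetwork.linkProb a b (hu - htb) c →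
      Pdb = UAVNetwork.linkProb a b (hu - hdb) c →
      -- the distances are finite random variables
      (Measurable Rtb ∧ ∀ᵐ ω ∂μ, Rtb ω ≠ ∞) ∧
      (Measurable Rdb ∧ ∀ᵐ ω ∂μ, Rdb ω ≠ ∞) ∧
      -- CDFs
      (∀ r : ℝ, 0 ≤ r →
        μ {ω | Rtb ω ≤ ENNReal.ofReal r} = ENNReal.ofReal (UAVNetwork.cdfTB ltb Ptb r)) ∧
      (∀ r : ℝ, y ≤ r →
        μ {ω | Rdb ω ≤ ENNReal.ofReal r} =
          ENNReal.ofReal (UAVNetwork.cdfDB ll lp Pdb r (Real.arcsin (y / r)))) ∧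
      (∀ r : ℝ, 0 ≤ r → r < y →
        μ {ω | Rdb ω ≤ ENNReal.ofReal r} = ENNReal.ofReal (UAVNetwork.cdfDBShort ll lp Pdb r)) ∧
      -- PDFs
      μ.map (fun ω => (Rtb ω).toReal) =
        volume.withDensity (fun r =>
          ENNReal.ofReal (if r ≤ 0 then 0 else UAVNetwork.pdfTB ltb Ptb r)) ∧
      μ.map (fun ω => (Rdb ω).toReal) =
        volume.withDensity (fun r =>
          ENNReal.ofReal (if r ≤ 0 then 0
            else if r < y then UAVNetwork.pdfDBShort ll lp Pdb r
            else UAVNetwork.pdfDB ll lp Pdb r (Real.arcsin (y / r)))) := by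
  rintro c _ _ rfl rfl _ _ rfl rfl
  have hcox := UAVNetwork.measurable_coxPoint hLT y φ₀
  -- Both kinds of link become markings with probability `linkProb`, so `c` needs no further case
  -- distinction.
  have hmtb := hStb.linkEvent hX.measurable (UAVNetwork.measurable_losProb b _ a)
    (fun x => (UAVNetwork.losProb_pos b _ ha x).le) (UAVNetwork.losProb_le_one b _ ha) c
  have hmdb := hSdb.linkEvent hcox (UAVNetwork.measurable_losProb b _ a)
    (fun x => (UAVNetwork.losProb_pos b _ ha x).le) (UAVNetwork.losProb_le_one b _ ha) c
  obtain ⟨ε, hε, hle⟩ := UAVNetwork.exists_pos_le_linkProb b (hu - htb) ha c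
  obtain ⟨δ, hδ, hlδ⟩ := UAVNetwork.exists_pos_le_linkProb b (hu - hdb) ha c
  obtain ⟨h1, h2, h3⟩ := UAVNetwork.nearestDist_planar hX hmtb
    (UAVNetwork.measurable_linkProb b _ a c) (UAVNetwork.linkProb_le_one b _ ha c) hε hle hltb
  obtain ⟨h4, h5, h6, h7⟩ := UAVNetwork.nearestDist_cox hLT hmdb
    (UAVNetwork.measurable_linkProb b _ a c) (UAVNetwork.linkProb_le_one b _ ha c) hδ hlδ hlp
    hll.le hy
  exact ⟨h1, h4, h2, h5, h6, h3, h7⟩
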